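/- Let $\sigma>0$, $\rho>0$ and $\theta\in\mathbb R$. Put $\mathcal R=[-1,1]\times[0,\rho]$, let $\mathcal C=\{(x_1,x_2,x_3): x_1^2+x_2^2=1,\ 0\le x_3\le\rho\}$ be the unit cylinder of length $\rho$, and let $\mathcal W=\mathcal W_1\cup\mathcal W_2$ be the two wires $$\mathcal W_1=\{(0,s,0):|s|\le1\},\qquad \mathcal W_2=\{(-s\sin\theta,\,s\cos\theta,\,\rho):|s|\le 1\}.$$ An admissible surface is the image $g(\mathcal R)$ of an injective map $g\in C^2(\mathcal R,\mathbb R^3)$ with $g([-1,1]\times\{0,\rho\})=\mathcal W$ and $g(\{-1,1\}\times(0,\rho))\subset\mathcal C$; its energy is $E(g)=\int_{\mathcal R}\sigma\,|g_y\times g_z|\,dy\,dz$, that is, $\sigma$ times its area. Let $\mathcal S_\theta$ be the helicoid parameterized by $$X(y,z)=\bigl(-y\sin(\theta z/\rho),\ y\cos(\theta z/\rho),\ z\bigr),\qquad (y,z)\in\mathcal R .$$ An admissible variation of $\mathcal S_\theta$ is a map $f\in C^2(I,C^2(\mathcal R,\mathbb R^3))$, with $I\ni 0$ an open interval, such that $f(t,\cdot)$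 parameterizes an admissible surface in the above sense for every $t\in I$ and $f(0,\cdot)=X$. If $$1<\sqrt{\frac{\pi^2-2\theta^2}{\rho^2}}\;\tanh\sqrt{\frac{\pi^2-2\theta^2}{\rho^2}}$$ (in particular $2\theta^2<\pi^2$), then $\mathcal S_\theta$ is stable, in the following sense. 1. $\mathcal S_\theta$ is admissible, and it is a critical point of $E$: for every admissible variation $f$, $\frac{d}{dt}E(f(t,\cdot))\big|_{t=0}=0$. 2. For every admissible variation $f$, the function $t\mapsto E(f(t,\cdot))$ is $C^2$ near $0$ and $\frac{d^2}{dt^2}E(f(t,\cdot))\big|_{t=0}\ge0$, with strict inequality unless the initial velocity $\partial_tf(0,\cdot)$ is everywhere tangent to $\mathcal S_\theta$. 3. $\mathcal S_\theta$ is a strict local minimizer of $E$: there is $\varepsilon>0$ such that every admissible parameterization $g$ with $|g-X|<\varepsilon$ and $\|Dg-DX\|<\varepsilon$ on $\mathcal R$ satisfies $E(g)\ge E(X)$, with equality only if $g(\mathcal R)=\mathcal S_\theta$. -/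

import Mathlib

open Set

noncomputable section

namespace SoapFilm

/-- Euclidean three-space. -/
abbrev E3 : Type := EuclideanSpace ℝ (Fin 3)

/-- The parameter rectangle `[-1,1] × [0,ρ]`, that is the flat reference surface. -/
def rect (ρ : ℝ) : Set (ℝ × ℝ) := Icc (-1) 1 ×ˢ Icc 0 ρ

/-- The two edges `z = 0` and `z = ρ` of the rectangle, where the wires are attached. -/
def wireEdges (ρ : ℝ) : Set (ℝ × ℝ) := Icc (-1) 1 ×ˢ {0, ρ}

/-- The part of the boundary of the rectangle that is not on the wire edges. -/
def lateralEdges (ρ : ℝ) : Set (ℝ × ℝ) := {-1, 1} ×ˢ Ioo 0 ρ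

instance compactSpace_rect (ρ : ℝ) : CompactSpace (rect ρ) :=
  isCompact_iff_compactSpace.mp (isCompact_Icc.prod isCompact_Icc)

/-- The inner wall of the tube: the unit cylinder of length `ρ` around the third axis. -/
def cylinder (ρ : ℝ) : Set E3 := {x | x 0 ^ 2 + x 1 ^ 2 = 1 ∧ x 2 ∈ Icc 0 ρ}

/-- The union of the two wires. Both are diameters of the tube, the first at height `0` along
the second axis, the other at height `ρ` and rotated by `θ`. -/
def wires (ρ θ : ℝ) : Set E3 :=
  {x | ∃ s ∈ Icc (-1 : ℝ) 1, x = !₂[0, s, 0]} ∪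
    {x | ∃ s ∈ Icc (-1 : ℝ) 1, x = !₂[-s * Real.sin θ, s * Real.cos θ, ρ]}

/-- `g` parametrizes a competitor: an injective `C²` image of the rectangle whose boundary
consists of the wires and of curves on the wall of the tube. -/
structure IsAdmissible (ρ θ : ℝ) (g : ℝ × ℝ → E3) : Prop where
  contDiffOn : ContDiffOn ℝ 2 g (rect ρ)
  injOn : InjOn g (rect ρ)
  image_wireEdges : g '' wireEdges ρ = wires ρ θ
  image_lateralEdges : g '' lateralEdges ρ ⊆ cylinder ρ

/-- The free energy: surface tension `σ` times the area. The integrand is the square root of the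
Gram determinant of the two partial derivatives, that is the norm of their cross product. -/
def energy (σ ρ : ℝ) (g : ℝ × ℝ → E3) : ℝ :=
  ∫ p in rect ρ, σ * Real.sqrt
    (‖fderivWithin ℝ g (rect ρ) p (1, 0)‖ ^ 2 * ‖fderivWithin ℝ g (rect ρ) p (0, 1)‖ ^ 2
      - (inner ℝ (fderivWithin ℝ g (rect ρ) p (1, 0))
          (fderivWithin ℝ g (rect ρ) p (0, 1))) ^ 2)

/-- The helicoid, `(y, z) ↦ (-y sin (θ z / ρ), y cos (θ z / ρ), z)`. -/
def helicoid (ρ θ : ℝ) (p : ℝ × ℝ) : E3 :=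
  !₂[-p.1 * Real.sin (θ * p.2 / ρ), p.1 * Real.cos (θ * p.2 / ρ), p.2]

/-- `f` is a twice continuously differentiable curve, over the set `I` of times, in the Banach
space of `C²` maps on the closed rectangle. This space embeds, by
`g ↦ (g, Dg, D²g)`, isometrically onto a closed subspace of a product of spaces of continuous maps with the
uniform norm, so the condition is that each of the three components is a `C²` curve. -/
def IsC2Curve (ρ : ℝ) (I : Set ℝ) (f : ℝ → ℝ × ℝ → E3) : Prop :=
  (∀ t ∈ I, ContDiffOn ℝ 2 (f t) (rect ρ)) ∧
  ∀ k : ℕ, k ≤ 2 →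
    ∃ Γ : ℝ → C(rect ρ, ContinuousMultilinearMap ℝ (fun _ : Fin k => ℝ × ℝ) E3),
      ContDiffOn ℝ 2 Γ I ∧
      ∀ t ∈ I, ∀ p : rect ρ, Γ t p = iteratedFDerivWithin ℝ k (f t) (rect ρ) p

/-- `f` is an admissible variation of the surface parametrized by `X`: a one-parameter family of
competitors, `C²` in time with values in the `C²` maps, that passes through `X` at time `0`. -/
def IsVariation (ρ θ : ℝ) (X : ℝ × ℝ → E3) (f : ℝ → ℝ × ℝ → E3) : Prop :=
  ∃ a b : ℝ, a < 0 ∧ 0 < b ∧ IsC2Curve ρ (Ioo a b) f ∧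
    (∀ t ∈ Ioo a b, IsAdmissible ρ θ (f t)) ∧ EqOn (f 0) X (rect ρ)

/-- The initial velocity of the variation `f` of `X` is tangent to the surface at every point,
that is, its normal component vanishes identically. -/
def HasTangentialVelocity (ρ : ℝ) (X : ℝ × ℝ → E3) (f : ℝ → ℝ × ℝ → E3) : Prop :=
  ∀ p ∈ rect ρ, ∃ w : ℝ × ℝ, deriv (fun t => f t p) 0 = fderivWithin ℝ X (rect ρ) p w

/-- The surface parametrized by `X` is a critical point: along every admissible variation the
energy has vanishing derivative. -/
def IsCritical (σ ρ θ : ℝ) (X : ℝ × ℝ → E3) : Prop :=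
  ∀ f, IsVariation ρ θ X f → HasDerivAt (fun t => energy σ ρ (f t)) 0 0

/-- The second variation of the energy exists and is nonnegative along every admissible
variation, and it is positive unless the initial velocity is tangential. -/
def HasPositiveSecondVariation (σ ρ θ : ℝ) (X : ℝ × ℝ → E3) : Prop :=
  ∀ f, IsVariation ρ θ X f →
    ContDiffAt ℝ 2 (fun t => energy σ ρ (f t)) 0 ∧
    0 ≤ deriv (deriv fun t => energy σ ρ (f t)) 0 ∧
    (¬ HasTangentialVelocity ρ X f → 0 < deriv (deriv fun t => energy σ ρ (f t)) 0)

/-- The surface parametrized by `X` is a strict local minimizer of the energy: every competitor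
that has a parametrization `C¹`-close to `X` has at least the energy of `X`, with equality only
if it is the same surface. -/
def IsStrictLocalMinimizer (σ ρ θ : ℝ) (X : ℝ × ℝ → E3) : Prop :=
  ∃ ε > 0, ∀ g, IsAdmissible ρ θ g →
    (∀ p ∈ rect ρ, ‖g p - X p‖ < ε ∧
      ‖fderivWithin ℝ g (rect ρ) p - fderivWithin ℝ X (rect ρ) p‖ < ε) →
    energy σ ρ X ≤ energy σ ρ g ∧
      (energy σ ρ g = energy σ ρ X → g '' rect ρ = X '' rect ρ)

/-- A stable surface is an admissible critical point of the energy with positive second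
variation that is a strict local minimizer. -/
structure IsStable (σ ρ θ : ℝ) (X : ℝ × ℝ → E3) : Prop where
  isAdmissible : IsAdmissible ρ θ X
  isCritical : IsCritical σ ρ θ X
  hasPositiveSecondVariation : HasPositiveSecondVariation σ ρ θ X
  isStrictLocalMinimizer : IsStrictLocalMinimizer σ ρ θ X

end SoapFilm

end

namespace SoapFilm

open MeasureTheory

/-! ### Calculus on the rectangle -/

/-! The helicoid is calibrated, with a quadratic surplus. Put a = θ/ρ and use coordinates (ξ, η, ζ)
that rotate with the height, so that the helicoid is ξ = 0 and the wall of the tube is ξ² + η² = 1.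
Take the exact 2-form dG ∧ dζ + dH ∧ dη, where G = `wtInt a η` - ξ² `frameCoef` / 2, H = ξ aη/w + ξ²
`axCoef` / 2 and w = `wt a η`. Restricted to the helicoid it is the area form. Two estimates hold
for surfaces C¹-close to the helicoid.

Interior: the form is at most the area density minus c ξ² (`exists_interior_bound`). At order ξ²
this is a Riccati-type inequality (`wt_mul_le_interior`) for coefficients built from the logarithmic
derivatives of the positive function cosh(κη) cos(ω(ζ - ρ/2)). It needs ω² > 2a² + κ²; positivity of
the cosine needs ωρ < π.

Boundary: by Stokes (`integral_jac`) the integral of the form is a boundary integral. The wire edges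
contribute nothing, because ξ = 0 and ζ is constant there. Each lateral edge contributes at least
what it does for the helicoid, provided κ tanh κ > 1 (`exists_boundary_bound`). The hypothesis of
the theorem supplies such κ and ω (`exists_frequencies`).

Hence E(g) ≥ E(X) + c ∫ ξ² for competitors g near X (`exists_energy_lower_bound`). Equality forces ξ
= 0, and then an open-and-closed argument shows that g covers the whole helicoid
(`NearHelicoid.exists_eq`). Criticality and the second variation need no variation formula: t ↦ E(f
t) is C² (`contDiffAt_energy`) and stays above a parabola touching it at t = 0
(`deriv_deriv_ge_of_parabola_le`). This parabola is nondegenerate when the initial velocity is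
somewhere not tangential (`exists_quadratic_growth`). -/

lemma uniqueDiffOn_rect {ρ : ℝ} (hρ : 0 < ρ) : UniqueDiffOn ℝ (rect ρ) :=
  (uniqueDiffOn_Icc (by norm_num)).prod (uniqueDiffOn_Icc hρ)

lemma isCompact_rect (ρ : ℝ) : IsCompact (rect ρ) := isCompact_Icc.prod isCompact_Icc

lemma interior_rect (ρ : ℝ) : interior (rect ρ) = Ioo (-1) 1 ×ˢ Ioo 0 ρ := by
  rw [rect, interior_prod_eq, interior_Icc, interior_Icc]

lemma rect_subset_closure_interior {ρ : ℝ} (hρ : 0 < ρ) :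
    rect ρ ⊆ closure (interior (rect ρ)) := by
  rw [interior_rect, closure_prod_eq, closure_Ioo (by norm_num), closure_Ioo hρ.ne, rect]

lemma rect_eq_Icc (ρ : ℝ) : rect ρ = Icc ((-1 : ℝ), (0 : ℝ)) (1, ρ) := by
  rw [rect, Icc_prod_Icc]

lemma mem_rect {ρ y z : ℝ} : (y, z) ∈ rect ρ ↔ (-1 ≤ y ∧ y ≤ 1) ∧ 0 ≤ z ∧ z ≤ ρ := by
  simp only [rect, mem_prod, mem_Icc]

lemma interior_rect_ae_eq (ρ : ℝ) :
    (interior (rect ρ) : Set (ℝ × ℝ)) =ᵐ[volume] rect ρ := by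
  rw [interior_rect, rect]
  exact Measure.set_prod_ae_eq Ioo_ae_eq_Icc Ioo_ae_eq_Icc

lemma measurableSet_rect (ρ : ℝ) : MeasurableSet (rect ρ) := (isCompact_rect ρ).measurableSet

lemma integrableOn_rect {ρ : ℝ} {F : ℝ × ℝ → ℝ} (hF : ContinuousOn F (rect ρ)) :
    IntegrableOn F (rect ρ) := hF.integrableOn_compact (isCompact_rect ρ)

/-- A nonnegative continuous function on the rectangle with vanishing integral is zero. -/
lemma eqOn_zero_of_setIntegral_eq_zero {ρ : ℝ} (hρ : 0 < ρ) {F : ℝ × ℝ → ℝ}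
    (hF : ContinuousOn F (rect ρ)) (h0 : ∀ p ∈ rect ρ, 0 ≤ F p)
    (hi : ∫ p in rect ρ, F p = 0) : ∀ p ∈ rect ρ, F p = 0 := by
  have h1 : F =ᵐ[volume.restrict (rect ρ)] 0 :=
    (setIntegral_eq_zero_iff_of_nonneg_ae
      ((ae_restrict_iff' (measurableSet_rect ρ)).2 (Filter.Eventually.of_forall h0))
      (integrableOn_rect hF)).1 hi
  exact Measure.eqOn_of_ae_eq h1 hF continuousOn_const (rect_subset_closure_interior hρ)

/-- The partial derivative in the first direction on the rectangle. -/
noncomputable def pdy (ρ : ℝ) (F : ℝ × ℝ → ℝ) (p : ℝ × ℝ) : ℝ := fderivWithin ℝ F (rect ρ) p (1, 0)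

/-- The partial derivative in the second direction on the rectangle. -/
noncomputable def pdz (ρ : ℝ) (F : ℝ × ℝ → ℝ) (p : ℝ × ℝ) : ℝ := fderivWithin ℝ F (rect ρ) p (0, 1)

/-- The Jacobian determinant of a pair of functions on the rectangle. -/
noncomputable def jac (ρ : ℝ) (F G : ℝ × ℝ → ℝ) (p : ℝ × ℝ) : ℝ :=
  pdy ρ F p * pdz ρ G p - pdz ρ F p * pdy ρ G p

section
variable {ρ : ℝ} {F G : ℝ × ℝ → ℝ}

lemma contDiffOn_fderivWithin_apply (hρ : 0 < ρ) {n : ℕ} (hF : ContDiffOn ℝ (n + 1) F (rect ρ))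
    (v : ℝ × ℝ) : ContDiffOn ℝ n (fun p => fderivWithin ℝ F (rect ρ) p v) (rect ρ) :=
  (hF.fderivWithin (uniqueDiffOn_rect hρ) le_rfl).clm_apply contDiffOn_const

lemma continuousOn_pdy (hρ : 0 < ρ) (hF : ContDiffOn ℝ 1 F (rect ρ)) :
    ContinuousOn (pdy ρ F) (rect ρ) :=
  (contDiffOn_fderivWithin_apply (n := 0) hρ (by simpa using hF) _).continuousOn

lemma continuousOn_pdz (hρ : 0 < ρ) (hF : ContDiffOn ℝ 1 F (rect ρ)) :
    ContinuousOn (pdz ρ F) (rect ρ) :=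
  (contDiffOn_fderivWithin_apply (n := 0) hρ (by simpa using hF) _).continuousOn

lemma contDiffOn_pdy (hρ : 0 < ρ) (hF : ContDiffOn ℝ 2 F (rect ρ)) :
    ContDiffOn ℝ 1 (pdy ρ F) (rect ρ) :=
  contDiffOn_fderivWithin_apply (n := 1) hρ (by norm_num; simpa using hF) _

lemma contDiffOn_pdz (hρ : 0 < ρ) (hF : ContDiffOn ℝ 2 F (rect ρ)) :
    ContDiffOn ℝ 1 (pdz ρ F) (rect ρ) :=
  contDiffOn_fderivWithin_apply (n := 1) hρ (by norm_num; simpa using hF) _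

lemma continuousOn_jac (hρ : 0 < ρ) (hF : ContDiffOn ℝ 1 F (rect ρ))
    (hG : ContDiffOn ℝ 1 G (rect ρ)) : ContinuousOn (jac ρ F G) (rect ρ) :=
  ((continuousOn_pdy hρ hF).mul (continuousOn_pdz hρ hG)).sub
    ((continuousOn_pdz hρ hF).mul (continuousOn_pdy hρ hG))

lemma hasDerivWithinAt_pdz {E : Type*} [NormedAddCommGroup E] [NormedSpace ℝ E]
    {F : ℝ × ℝ → E} (hF : DifferentiableOn ℝ F (rect ρ)) {y z : ℝ}
    (hy : y ∈ Icc (-1 : ℝ) 1) (hz : z ∈ Icc 0 ρ) :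
    HasDerivWithinAt (fun z => F (y, z)) (fderivWithin ℝ F (rect ρ) (y, z) (0, 1)) (Icc 0 ρ) z :=
  (hF (y, z) ⟨hy, hz⟩).hasFDerivWithinAt.comp_hasDerivWithinAt (t := rect ρ) z
    ((hasDerivWithinAt_const z _ y).prodMk (hasDerivWithinAt_id z _)) (fun _ h => mem_prod.2 ⟨hy, h⟩)

lemma hasDerivWithinAt_pdy {E : Type*} [NormedAddCommGroup E] [NormedSpace ℝ E]
    {F : ℝ × ℝ → E} (hF : DifferentiableOn ℝ F (rect ρ)) {y z : ℝ}
    (hy : y ∈ Icc (-1 : ℝ) 1) (hz : z ∈ Icc 0 ρ) :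
    HasDerivWithinAt (fun y => F (y, z)) (fderivWithin ℝ F (rect ρ) (y, z) (1, 0))
      (Icc (-1) 1) y :=
  (hF (y, z) ⟨hy, hz⟩).hasFDerivWithinAt.comp_hasDerivWithinAt (t := rect ρ) y
    ((hasDerivWithinAt_id y _).prodMk (hasDerivWithinAt_const y _ z)) (fun _ h => mem_prod.2 ⟨h, hz⟩)

lemma rect_mem_nhds {p : ℝ × ℝ} (hp : p ∈ interior (rect ρ)) : rect ρ ∈ nhds p :=
  mem_interior_iff_mem_nhds.1 hp

lemma pdz_pdy_eq (hF : ContDiffOn ℝ 2 F (rect ρ)) {p : ℝ × ℝ} (hp : p ∈ interior (rect ρ)) :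
    pdz ρ (pdy ρ F) p = pdy ρ (pdz ρ F) p := by
  have hn := rect_mem_nhds hp
  have hat : ContDiffAt ℝ 2 F p := hF.contDiffAt hn
  have hd : DifferentiableAt ℝ (fderiv ℝ F) p :=
    (hat.fderiv_right (m := 1) (by norm_num)).differentiableAt (by norm_num)
  have key : ∀ v w : ℝ × ℝ,
      fderivWithin ℝ (fun q => fderivWithin ℝ F (rect ρ) q v) (rect ρ) p w
        = fderiv ℝ (fderiv ℝ F) p w v := by
    intro v w
    rw [fderivWithin_of_mem_nhds hn]
    have : (fun q => fderivWithin ℝ F (rect ρ) q v) =ᶠ[nhds p] fun q => fderiv ℝ F q v := by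
      filter_upwards [isOpen_interior.mem_nhds hp] with q hq
      rw [fderivWithin_of_mem_nhds (rect_mem_nhds hq)]
    rw [this.fderiv_eq, fderiv_clm_apply hd (differentiableAt_const v)]
    simp
  have hs : IsSymmSndFDerivAt ℝ F p := hat.isSymmSndFDerivAt (by simp)
  unfold pdz pdy
  rw [key, key]
  exact hs _ _

/-- Stokes' theorem for the pull-back of `dF ∧ dG`. -/
theorem integral_jac (hρ : 0 < ρ) (hF : ContDiffOn ℝ 1 F (rect ρ))
    (hG : ContDiffOn ℝ 2 G (rect ρ)) :
    ∫ p in rect ρ, jac ρ F G p =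
      ((∫ z in (0 : ℝ)..ρ, F (1, z) * pdz ρ G (1, z)) -
        ∫ z in (0 : ℝ)..ρ, F (-1, z) * pdz ρ G (-1, z)) -
      ((∫ y in (-1 : ℝ)..1, F (y, ρ) * pdy ρ G (y, ρ)) -
        ∫ y in (-1 : ℝ)..1, F (y, 0) * pdy ρ G (y, 0)) := by
  have hGz := contDiffOn_pdz hρ hG
  have hGy := contDiffOn_pdy hρ hG
  -- The field (F G_z, -F G_y) has divergence `jac ρ F G`, because the mixed second derivatives of G
  -- cancel. This is why G must be C² while F need only be C¹.
  have hint : ∀ p ∈ interior (rect ρ),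
      fderiv ℝ (fun p => F p * pdz ρ G p) p (1, 0) +
        fderiv ℝ (fun p => -(F p * pdy ρ G p)) p (0, 1) = jac ρ F G p := by
    intro p hp
    have hn := rect_mem_nhds hp
    have dF := (hF.contDiffAt hn).differentiableAt (by norm_num)
    have dGz := (hGz.contDiffAt hn).differentiableAt (by norm_num)
    have dGy := (hGy.contDiffAt hn).differentiableAt (by norm_num)
    have hsym := pdz_pdy_eq hG hp
    rw [fderiv_fun_neg, fderiv_fun_mul dF dGz, fderiv_fun_mul dF dGy]
    unfold jac
    simp only [pdy, pdz] at hsym ⊢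
    simp only [fderivWithin_of_mem_nhds hn] at hsym ⊢
    simp only [add_apply, neg_apply, smul_apply, smul_eq_mul]
    rw [hsym]; ring
  have hi0 : IntegrableOn (jac ρ F G) (rect ρ) :=
    integrableOn_rect (continuousOn_jac hρ hF (hG.of_le (by norm_num)))
  have hae := interior_rect_ae_eq ρ
  have h := integral_divergence_prod_Icc_of_hasFDerivAt_of_le
    (fun p => F p * pdz ρ G p) (fun p => -(F p * pdy ρ G p))
    (fderiv ℝ (fun p => F p * pdz ρ G p)) (fderiv ℝ (fun p => -(F p * pdy ρ G p)))
    (-1, 0) (1, ρ) (by simp [Prod.le_def, hρ.le])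
    (by rw [← rect_eq_Icc]; exact hF.continuousOn.mul hGz.continuousOn)
    (by rw [← rect_eq_Icc]; exact (hF.continuousOn.mul hGy.continuousOn).neg)
    (by
      intro p hp
      rw [← interior_rect] at hp
      have hn := rect_mem_nhds hp
      exact (((hF.mul hGz).contDiffAt hn).differentiableAt (by norm_num)).hasFDerivAt)
    (by
      intro p hp
      rw [← interior_rect] at hp
      have hn := rect_mem_nhds hp
      exact (((hF.mul hGy).neg.contDiffAt hn).differentiableAt (by norm_num)).hasFDerivAt)
    (by
      rw [← rect_eq_Icc]
      refine IntegrableOn.congr_set_ae ?_ hae.symm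
      exact (hi0.mono_set interior_subset).congr_fun (fun p hp => (hint p hp).symm)
        isOpen_interior.measurableSet)
  rw [← rect_eq_Icc, ← setIntegral_congr_set hae,
    setIntegral_congr_fun isOpen_interior.measurableSet hint, setIntegral_congr_set hae] at h
  rw [h]
  simp only [intervalIntegral.integral_neg]
  ring

end

/-! ### The coefficients of the calibration -/

/-- The area density of the helicoid of pitch `a`. -/
noncomputable def wt (a η : ℝ) : ℝ := Real.sqrt (1 + a ^ 2 * η ^ 2)

/-- The odd primitive of the area density. -/
noncomputable def wtInt (a η : ℝ) : ℝ := ∫ t in (0 : ℝ)..η, wt a t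

/-- The radial component of the transverse derivative of the calibrating field. -/
noncomputable def radCoef (a κ η : ℝ) : ℝ :=
  -(κ * (Real.sinh (κ * η) / Real.cosh (κ * η))) / (wt a η ^ 2 * wt a 1) - a ^ 2 * η / wt a η ^ 3

/-- The radial component expressed in the coordinates of the rotating frame. -/
noncomputable def frameCoef (a κ η : ℝ) : ℝ := radCoef a κ η - a ^ 2 * η / wt a η

/-- The derivative of `frameCoef`. -/
noncomputable def frameCoefDeriv (a κ η : ℝ) : ℝ :=
  -(κ ^ 2 - (κ * (Real.sinh (κ * η) / Real.cosh (κ * η))) ^ 2) / (wt a η ^ 2 * wt a 1) +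
    2 * (κ * (Real.sinh (κ * η) / Real.cosh (κ * η))) * a ^ 2 * η / (wt a η ^ 4 * wt a 1) -
    2 * a ^ 2 / wt a η ^ 3 + 3 * a ^ 4 * η ^ 2 / wt a η ^ 5

/-- The axial component of the transverse derivative of the calibrating field. -/
noncomputable def axCoef (a ω ρ η ζ : ℝ) : ℝ := ω * Real.tan (ω * (ζ - ρ / 2)) / wt a η ^ 3

/-- The derivative of `axCoef` in the axial direction. -/
noncomputable def axCoefDeriv (a ω ρ η ζ : ℝ) : ℝ :=
  ω ^ 2 * (1 + Real.tan (ω * (ζ - ρ / 2)) ^ 2) / wt a η ^ 3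

section
variable (a κ ω ρ : ℝ)

lemma wt_sq (η : ℝ) : wt a η ^ 2 = 1 + a ^ 2 * η ^ 2 := Real.sq_sqrt (by positivity)

lemma one_le_wt (η : ℝ) : 1 ≤ wt a η := by
  rw [wt, Real.one_le_sqrt]; nlinarith [mul_nonneg (sq_nonneg a) (sq_nonneg η)]

lemma wt_pos (η : ℝ) : 0 < wt a η := lt_of_lt_of_le one_pos (one_le_wt a η)

lemma wt_neg (η : ℝ) : wt a (-η) = wt a η := by simp [wt]

lemma wt_le_wt_one {η : ℝ} (h : |η| ≤ 1) : wt a η ≤ wt a 1 := by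
  apply Real.sqrt_le_sqrt
  have : η ^ 2 ≤ 1 := by rw [← sq_abs]; nlinarith [abs_nonneg η]
  nlinarith [sq_nonneg a]

lemma contDiff_wt {n : ℕ∞} : ContDiff ℝ n (wt a) := by
  unfold wt
  refine ContDiff.sqrt (by fun_prop) fun η => ?_
  positivity

lemma continuous_wt : Continuous (wt a) := (contDiff_wt a (n := 0)).continuous

lemma hasDerivAt_wt (η : ℝ) : HasDerivAt (wt a) (a ^ 2 * η / wt a η) η := by
  have h : HasDerivAt (fun η : ℝ => 1 + a ^ 2 * η ^ 2) (a ^ 2 * (2 * η)) η := by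
    simpa using ((hasDerivAt_pow 2 η).const_mul (a ^ 2)).const_add 1
  have h2 := h.sqrt (by positivity)
  have h3 : a ^ 2 * (2 * η) / (2 * Real.sqrt (1 + a ^ 2 * η ^ 2)) = a ^ 2 * η / wt a η := by
    rw [show a ^ 2 * (2 * η) = 2 * (a ^ 2 * η) by ring, mul_div_mul_left _ _ two_ne_zero, wt]
  rwa [h3] at h2

lemma hasDerivAt_wtInt (η : ℝ) : HasDerivAt (wtInt a) (wt a η) η :=
  (continuous_wt a).integral_hasStrictDerivAt 0 η |>.hasDerivAt

lemma wtInt_neg (η : ℝ) : wtInt a (-η) = -wtInt a η := by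
  have h := intervalIntegral.integral_comp_neg (a := 0) (b := η) (wt a)
  simp only [wt_neg, neg_zero] at h
  rw [wtInt, wtInt, h, intervalIntegral.integral_symm]

lemma contDiff_wtInt : ContDiff ℝ 1 (wtInt a) := by
  rw [contDiff_one_iff_deriv]
  refine ⟨fun η => (hasDerivAt_wtInt a η).differentiableAt, ?_⟩
  rw [show deriv (wtInt a) = wt a from funext fun η => (hasDerivAt_wtInt a η).deriv]
  exact continuous_wt a

/-- The density is at most its value at 1. This bounds the loss in the boundary term when a wall
point has η < 1. -/
lemma wtInt_one_le {η : ℝ} (h0 : 0 ≤ η) (h1 : η ≤ 1) :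
    wtInt a 1 ≤ wtInt a η + wt a 1 * (1 - η) := by
  have hi : ∀ x y : ℝ, IntervalIntegrable (wt a) MeasureTheory.volume x y :=
    fun x y => (continuous_wt a).intervalIntegrable x y
  have h2 : wtInt a η + ∫ t in η..1, wt a t = wtInt a 1 :=
    intervalIntegral.integral_add_adjacent_intervals (hi _ _) (hi _ _)
  have h3 : ∫ t in η..1, wt a t ≤ ∫ t in η..1, wt a 1 := by
    refine intervalIntegral.integral_mono_on h1 (hi _ _) (by simp) fun t ht => ?_
    exact wt_le_wt_one a (abs_le.2 ⟨by linarith [ht.1], ht.2⟩)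
  simp only [intervalIntegral.integral_const, smul_eq_mul] at h3
  linarith

lemma radCoef_neg (η : ℝ) : radCoef a κ (-η) = -radCoef a κ η := by
  simp only [radCoef, wt_neg, mul_neg, Real.sinh_neg, Real.cosh_neg]; ring

/-- Oddness, here and for `wtInt`, reduces the edge y = -1 to the edge y = 1 by a half-turn about
the axis. -/
lemma frameCoef_neg (η : ℝ) : frameCoef a κ (-η) = -frameCoef a κ η := by
  simp only [frameCoef, wt_neg, radCoef_neg]; ring

lemma contDiff_radCoef {n : ℕ∞} : ContDiff ℝ n (radCoef a κ) := by
  unfold radCoef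
  have h1 : ContDiff ℝ n (fun η => Real.sinh (κ * η)) := Real.contDiff_sinh.comp (by fun_prop)
  have h2 : ContDiff ℝ n (fun η => Real.cosh (κ * η)) := Real.contDiff_cosh.comp (by fun_prop)
  have h3 := contDiff_wt a (n := n)
  refine ContDiff.sub (ContDiff.div ?_ ?_ ?_) (ContDiff.div (by fun_prop) (h3.pow 3) ?_)
  · exact (contDiff_const.mul (h1.div h2 fun η => (Real.cosh_pos _).ne')).neg
  · exact (h3.pow 2).mul contDiff_const
  · intro η; have := wt_pos a η; have := wt_pos a 1; positivity
  · intro η; have := wt_pos a η; positivity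

lemma contDiff_angCoef {n : ℕ∞} : ContDiff ℝ n (fun η => a * η / wt a η) :=
  ContDiff.div (by fun_prop) (contDiff_wt a) fun η => (wt_pos a η).ne'

lemma contDiff_frameCoef {n : ℕ∞} : ContDiff ℝ n (frameCoef a κ) := by
  unfold frameCoef
  refine (contDiff_radCoef a κ).sub (ContDiff.div (by fun_prop) (contDiff_wt a) ?_)
  exact fun η => (wt_pos a η).ne'

lemma hasDerivAt_frameCoef (η : ℝ) : HasDerivAt (frameCoef a κ) (frameCoefDeriv a κ η) η := by
  have hw := hasDerivAt_wt a η
  have hw0 := (wt_pos a η).ne'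
  have hw1 := (wt_pos a 1).ne'
  have hc := (Real.cosh_pos (κ * η)).ne'
  have hk : HasDerivAt (fun η => κ * η) κ η := by simpa using (hasDerivAt_id η).const_mul κ
  have hs := ((hk.sinh.div hk.cosh hc).const_mul κ).neg
  have h1 := hs.div ((hw.pow 2).mul_const (wt a 1))
    (mul_ne_zero (pow_ne_zero 2 hw0) hw1)
  have h2 := ((hasDerivAt_id η).const_mul (a ^ 2)).div (hw.pow 3) (pow_ne_zero 3 hw0)
  have h3 := ((hasDerivAt_id η).const_mul (a ^ 2)).div hw hw0
  refine HasDerivAt.congr_deriv (f := frameCoef a κ) ((h1.sub h2).sub h3) (Eq.symm ?_)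
  have hch := Real.cosh_sq (κ * η)
  have hcs : (Real.cosh (κ * η) * κ * Real.cosh (κ * η) - Real.sinh (κ * η) *
      (Real.sinh (κ * η) * κ)) / Real.cosh (κ * η) ^ 2
      = κ * (1 - (Real.sinh (κ * η) / Real.cosh (κ * η)) ^ 2) := by
    field_simp
  change frameCoefDeriv a κ η =
    (-(κ * ((Real.cosh (κ * η) * κ * Real.cosh (κ * η) - Real.sinh (κ * η) *
          (Real.sinh (κ * η) * κ)) / Real.cosh (κ * η) ^ 2)) * (wt a η ^ 2 * wt a 1) -
        (-(κ * (Real.sinh (κ * η) / Real.cosh (κ * η)))) *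
          (((2 : ℕ) : ℝ) * wt a η ^ (2 - 1) * (a ^ 2 * η / wt a η) * wt a 1)) /
      (wt a η ^ 2 * wt a 1) ^ 2 -
      (a ^ 2 * 1 * wt a η ^ 3 - a ^ 2 * η * (((3 : ℕ) : ℝ) * wt a η ^ (3 - 1) *
        (a ^ 2 * η / wt a η))) / (wt a η ^ 3) ^ 2 -
      (a ^ 2 * 1 * wt a η - a ^ 2 * η * (a ^ 2 * η / wt a η)) / wt a η ^ 2
  rw [hcs]
  unfold frameCoefDeriv
  generalize Real.sinh (κ * η) / Real.cosh (κ * η) = t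
  have hsq := wt_sq a η
  generalize wt a η = w at *
  generalize wt a 1 = v at *
  field_simp
  push_cast
  ring_nf
  have e4 : w ^ 4 = (1 + a ^ 2 * η ^ 2) ^ 2 := by rw [← hsq]; ring
  have e6 : w ^ 6 = (1 + a ^ 2 * η ^ 2) ^ 3 := by rw [← hsq]; ring
  simp only [hsq, e4, e6]
  ring

/-- Riccati-type inequality: the derivatives of the coefficients dominate their squares by a uniform
positive margin. The squares come from renormalizing the calibrating field to length at most one,
the derivatives from making its form closed. -/
lemma wt_mul_le_interior {η : ℝ} (hη : |η| ≤ 1) (ζ : ℝ) (h : 0 < ω ^ 2 - 2 * a ^ 2 - κ ^ 2) :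
    (ω ^ 2 - 2 * a ^ 2 - κ ^ 2) / wt a 1 ^ 3 ≤
      frameCoefDeriv a κ η + axCoefDeriv a ω ρ η ζ -
        wt a η * (axCoef a ω ρ η ζ ^ 2 * wt a η ^ 2 + radCoef a κ η ^ 2) := by
  have hw := wt_pos a η
  have hw1 := one_le_wt a 1
  have hww := wt_le_wt_one a hη
  have hsq := wt_sq a η
  have ht : (Real.sinh (κ * η) / Real.cosh (κ * η)) ^ 2 ≤ 1 := by
    rw [div_pow, div_le_one (by have := Real.cosh_pos (κ * η); positivity), Real.cosh_sq]
    linarith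
  have hle : (ω ^ 2 - 2 * a ^ 2 - κ ^ 2) / wt a 1 ^ 3 ≤ (ω ^ 2 - 2 * a ^ 2 - κ ^ 2) / wt a η ^ 3 := by
    gcongr
  refine hle.trans ?_
  unfold frameCoefDeriv axCoefDeriv axCoef radCoef
  generalize Real.sinh (κ * η) / Real.cosh (κ * η) = t at *
  generalize Real.tan (ω * (ζ - ρ / 2)) = T at *
  generalize wt a η = w at *
  generalize wt a 1 = v at *
  have hv : 0 < v := by linarith
  -- With t = tanh(κη), w the density at η and v the density at 1, the surplus over ω² - 2a² - κ² is
  -- a sum of three terms, nonnegative because t² ≤ 1, w ≤ v and v ≥ 1. Dividing by v rather than w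
  -- in `radCoef` is what produces the factor 1 - w/v.
  have key : -(κ ^ 2 - (κ * t) ^ 2) / (w ^ 2 * v) + 2 * (κ * t) * a ^ 2 * η / (w ^ 4 * v) -
        2 * a ^ 2 / w ^ 3 + 3 * a ^ 4 * η ^ 2 / w ^ 5 + ω ^ 2 * (1 + T ^ 2) / w ^ 3 -
      w * ((ω * T / w ^ 3) ^ 2 * w ^ 2 + (-(κ * t) / (w ^ 2 * v) - a ^ 2 * η / w ^ 3) ^ 2)
      = (ω ^ 2 - 2 * a ^ 2 - κ ^ 2 + (κ ^ 2 * (1 - t ^ 2) * (1 - w / v) +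
          (κ * t) ^ 2 * (1 - 1 / v ^ 2) + 2 * (a ^ 2 * η / w) ^ 2)) / w ^ 3 := by
    field_simp
    ring
  rw [key]
  gcongr
  have e1 : 0 ≤ 1 - w / v := by rw [sub_nonneg, div_le_one hv]; exact hww
  have e2 : 0 ≤ 1 - 1 / v ^ 2 := by
    rw [sub_nonneg, div_le_one (by positivity)]; nlinarith
  have e3 : 0 ≤ 1 - t ^ 2 := by linarith
  have : 0 ≤ κ ^ 2 * (1 - t ^ 2) * (1 - w / v) + (κ * t) ^ 2 * (1 - 1 / v ^ 2) +
    2 * (a ^ 2 * η / w) ^ 2 := by positivity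
  linarith

end

/-! ### The pointwise calibration inequality -/

/-- The field with components
`((1 - ξ² m / 2) / w - ξ a η τ, ξ r, a η (1 - ξ² m / 2) / w + ξ τ)` has length at most one, and its
flux is, up to a controlled error, the one of a closed form. -/
lemma calibration_pointwise {a ξ η w τ r c' τ' m b d M1 M2 M3 : ℝ} (hw : 0 < w)
    (hsq : w ^ 2 = 1 + a ^ 2 * η ^ 2) (hm : m = τ ^ 2 * w ^ 2 + r ^ 2 + d)
    (hξ : ξ ^ 2 * m ^ 2 ≤ 4 * d) (hb : b ≤ c' + τ' - w * (τ ^ 2 * w ^ 2 + r ^ 2))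
    (hb0 : 0 ≤ b) (hd : w * d ≤ b / 2) (hM1 : 1 / 2 ≤ M1)
    (herr : |(-a * τ + ξ * a * m * (a * η / w) / 2) * M2 - m * (a * η / w) * M3 / 2| ≤ b / 16) :
    w * M1 + ξ * (r - a ^ 2 * η / w) * M2 - ξ ^ 2 * c' * M1 / 2 + a * η / w * M3 + ξ * τ * M3 -
        ξ ^ 2 * τ' * M1 / 2 + b / 16 * ξ ^ 2 ≤
      Real.sqrt (M1 ^ 2 + M2 ^ 2 + (M3 - a * ξ * M2 + a * η * M1) ^ 2) := by
  set W1 := (1 - ξ ^ 2 * m / 2) / w - ξ * (a * η) * τ with hW1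
  set W2 := ξ * r with hW2
  set W3 := a * η * (1 - ξ ^ 2 * m / 2) / w + ξ * τ with hW3
  set V3 := M3 - a * ξ * M2 + a * η * M1 with hV3
  -- The first-order part ξ(-aητ, r, τ) is orthogonal to the unit normal (1, 0, aη)/w, so only ξ²
  -- terms spoil the unit length. The factor 1 - ξ²m/2 removes them and leaves the slack -dξ², which
  -- absorbs the quartic term.
  have hnorm : W1 ^ 2 + W2 ^ 2 + W3 ^ 2 = 1 - d * ξ ^ 2 + ξ ^ 2 * (ξ ^ 2 * m ^ 2) / 4 := by
    have : W1 ^ 2 + W2 ^ 2 + W3 ^ 2 =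
        (1 - ξ ^ 2 * m / 2) ^ 2 * (1 + a ^ 2 * η ^ 2) / w ^ 2 +
          ξ ^ 2 * (τ ^ 2 * (1 + a ^ 2 * η ^ 2) + r ^ 2) := by
      rw [hW1, hW2, hW3]; field_simp; ring
    rw [this, ← hsq, mul_div_assoc, div_self (by positivity), hm]
    ring
  have hnorm1 : W1 ^ 2 + W2 ^ 2 + W3 ^ 2 ≤ 1 := by
    rw [hnorm]; nlinarith [sq_nonneg ξ]
  have hcs : W1 * M1 + W2 * M2 + W3 * V3 ≤ Real.sqrt (M1 ^ 2 + M2 ^ 2 + V3 ^ 2) := by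
    apply Real.le_sqrt_of_sq_le
    have h1 : (W1 * M1 + W2 * M2 + W3 * V3) ^ 2 ≤
        (W1 ^ 2 + W2 ^ 2 + W3 ^ 2) * (M1 ^ 2 + M2 ^ 2 + V3 ^ 2) := by
      have e : (W1 ^ 2 + W2 ^ 2 + W3 ^ 2) * (M1 ^ 2 + M2 ^ 2 + V3 ^ 2) =
          (W1 * M1 + W2 * M2 + W3 * V3) ^ 2 + ((W1 * M2 - W2 * M1) ^ 2 +
            (W1 * V3 - W3 * M1) ^ 2 + (W2 * V3 - W3 * M2) ^ 2) := by ring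
      rw [e]
      exact le_add_of_nonneg_right (by positivity)
    have h2 : 0 ≤ M1 ^ 2 + M2 ^ 2 + V3 ^ 2 := by positivity
    exact h1.trans (mul_le_of_le_one_left h2 hnorm1)
  refine le_trans ?_ hcs
  -- The flux agrees with the closed form up to ξ² terms: w·m stands in place of the derivatives c'
  -- + τ', and the remaining bracket is small with `M2` and `M3`.
  have hid : W1 * M1 + W2 * M2 + W3 * V3 =
      w * M1 + ξ * (r - a ^ 2 * η / w) * M2 + a * η / w * M3 + ξ * τ * M3 -
        ξ ^ 2 * (w * m) * M1 / 2 +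
      ξ ^ 2 * ((-a * τ + ξ * a * m * (a * η / w) / 2) * M2 - m * (a * η / w) * M3 / 2) := by
    have : W1 * M1 + W2 * M2 + W3 * V3 =
      (1 - ξ ^ 2 * m / 2) * (1 + a ^ 2 * η ^ 2) / w * M1 +
        ξ * (r - a ^ 2 * η / w) * M2 + a * η / w * M3 + ξ * τ * M3 +
      ξ ^ 2 * ((-a * τ + ξ * a * m * (a * η / w) / 2) * M2 - m * (a * η / w) * M3 / 2) := by
      rw [hW1, hW2, hW3, hV3]; field_simp; ring
    rw [this, ← hsq]
    field_simp
    ring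
  rw [hid]
  -- The margin b loses half to w·d and another half to `M1 ≥ 1/2`. After the factor 1/2 in the
  -- form, b/8 remains; the error takes b/16 and leaves the claimed b/16.
  have h2 : b / 4 ≤ (c' + τ' - w * m) * M1 := by
    have h3 : b / 2 ≤ c' + τ' - w * m := by rw [hm]; linarith
    calc b / 4 = b / 2 * (1 / 2) := by ring
      _ ≤ (c' + τ' - w * m) * M1 := mul_le_mul h3 hM1 (by norm_num) (by linarith)
  have h1 := mul_le_mul_of_nonneg_left (abs_le.1 herr).1 (sq_nonneg ξ)
  have h2 := mul_le_mul_of_nonneg_left h2 (sq_nonneg ξ)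
  generalize (-a * τ + ξ * a * m * (a * η / w) / 2) * M2 - m * (a * η / w) * M3 / 2 = e at h1 ⊢
  generalize w * m = wm at h2 ⊢
  linarith

/-! ### Uniform interior and boundary estimates -/

section
variable {a κ ω ρ : ℝ}

lemma cos_axial_pos (hω : 0 < ω) (hωρ : ω * ρ < Real.pi) {ζ : ℝ} (h0 : 0 ≤ ζ) (h1 : ζ ≤ ρ) :
    0 < Real.cos (ω * (ζ - ρ / 2)) := by
  apply Real.cos_pos_of_mem_Ioo
  constructor <;> nlinarith

lemma hasDerivAt_tan_axial (hω : 0 < ω) (hωρ : ω * ρ < Real.pi) {ζ : ℝ} (h0 : 0 ≤ ζ)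
    (h1 : ζ ≤ ρ) : HasDerivAt (fun ζ => ω * Real.tan (ω * (ζ - ρ / 2)))
      (ω ^ 2 * (1 + Real.tan (ω * (ζ - ρ / 2)) ^ 2)) ζ := by
  have hc := (cos_axial_pos hω hωρ h0 h1).ne'
  have h : HasDerivAt (fun ζ => ω * (ζ - ρ / 2)) ω ζ := by
    simpa using ((hasDerivAt_id ζ).sub_const (ρ / 2)).const_mul ω
  refine (((Real.hasDerivAt_tan hc).comp ζ h).const_mul ω).congr_deriv ?_
  rw [← Real.inv_one_add_tan_sq hc]
  field_simp

lemma exists_coef_bound (hρ : 0 < ρ) (hω : 0 < ω) (hωρ : ω * ρ < Real.pi) :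
    ∃ M, 1 ≤ M ∧ |a| ≤ M ∧ ∀ η ζ, |η| ≤ 1 → 0 ≤ ζ → ζ ≤ ρ →
      |axCoef a ω ρ η ζ| ≤ M ∧ |radCoef a κ η| ≤ M ∧ |a * η / wt a η| ≤ M := by
  obtain ⟨M1, h1⟩ := isCompact_Icc.exists_bound_of_continuousOn (s := Icc (-1 : ℝ) 1)
    ((contDiff_radCoef a κ (n := 0)).continuous.continuousOn)
  obtain ⟨M2, h2⟩ := isCompact_Icc.exists_bound_of_continuousOn (s := Icc 0 ρ)
    (f := fun ζ => ω * Real.tan (ω * (ζ - ρ / 2)))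
    (fun ζ hζ => (hasDerivAt_tan_axial hω hωρ hζ.1 hζ.2).continuousAt.continuousWithinAt)
  have p1 : 0 ≤ M1 := (norm_nonneg _).trans (h1 0 (by simp))
  have p2 : 0 ≤ M2 := (norm_nonneg _).trans (h2 0 (by simp [hρ.le]))
  have pa := abs_nonneg a
  refine ⟨1 + |a| + M1 + M2, by linarith, by linarith, fun η ζ hη h0 hr => ⟨?_, ?_, ?_⟩⟩
  · have := h2 ζ ⟨h0, hr⟩
    rw [axCoef, abs_div, abs_of_pos (pow_pos (wt_pos a η) 3)]
    have hw : 1 ≤ wt a η ^ 3 := one_le_pow₀ (one_le_wt a η)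
    refine (div_le_self (abs_nonneg _) hw).trans ?_
    rw [Real.norm_eq_abs] at this
    linarith
  · have := h1 η (abs_le.1 hη)
    rw [Real.norm_eq_abs] at this
    linarith
  · rw [abs_div, abs_of_pos (wt_pos a η)]
    refine (div_le_self (abs_nonneg _) (one_le_wt a η)).trans ?_
    rw [abs_mul]
    nlinarith

/-- Uniform version of `calibration_pointwise`: the coefficients are bounded on the solid tube, so
one smallness threshold serves all points. -/
lemma exists_interior_bound (hρ : 0 < ρ) (hω : 0 < ω) (hωρ : ω * ρ < Real.pi)
    (h : 0 < ω ^ 2 - 2 * a ^ 2 - κ ^ 2) :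
    ∃ δ > 0, ∃ c > 0, ∀ ξ η ζ M1 M2 M3 : ℝ, |ξ| ≤ δ → |η| ≤ 1 → 0 ≤ ζ → ζ ≤ ρ →
      1 / 2 ≤ M1 → |M2| ≤ δ → |M3| ≤ δ →
      wt a η * M1 + ξ * frameCoef a κ η * M2 - ξ ^ 2 * frameCoefDeriv a κ η * M1 / 2 +
        a * η / wt a η * M3 + ξ * axCoef a ω ρ η ζ * M3 -
        ξ ^ 2 * axCoefDeriv a ω ρ η ζ * M1 / 2 + c * ξ ^ 2 ≤
      Real.sqrt (M1 ^ 2 + M2 ^ 2 + (M3 - a * ξ * M2 + a * η * M1) ^ 2) := by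
  obtain ⟨M, hM1, hMa, hM⟩ := exists_coef_bound (a := a) (κ := κ) hρ hω hωρ
  have hw1 := wt_pos a 1
  obtain ⟨b, hb⟩ : ∃ b, b = (ω ^ 2 - 2 * a ^ 2 - κ ^ 2) / wt a 1 ^ 3 := ⟨_, rfl⟩
  have hb0 : 0 < b := by rw [hb]; positivity
  -- The slack d costs w·d ≤ b/2 in the margin, and d ≤ 1 makes d² ≤ 4d, as needed for the length
  -- bound.
  obtain ⟨d, hd⟩ : ∃ d, d = min 1 (b / (2 * wt a 1)) := ⟨_, rfl⟩
  have hd0 : 0 < d := by rw [hd]; positivity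
  have hd1 : d ≤ 1 := by rw [hd]; exact min_le_left _ _
  have hd2 : wt a 1 * d ≤ b / 2 := by
    have : d ≤ b / (2 * wt a 1) := by rw [hd]; exact min_le_right _ _
    calc wt a 1 * d ≤ wt a 1 * (b / (2 * wt a 1)) := by gcongr
      _ = b / 2 := by field_simp
  obtain ⟨N, hN⟩ : ∃ N, N = M ^ 2 * wt a 1 ^ 2 + M ^ 2 + 1 := ⟨_, rfl⟩
  have hN1 : 1 ≤ N := by rw [hN]; nlinarith [sq_nonneg (M * wt a 1), sq_nonneg M]
  have hN0 : 0 < N := by linarith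
  -- Here N bounds m. The first entry gives |ξ| m ≤ d; the second keeps the error bracket below
  -- b/16.
  obtain ⟨δ, hδ⟩ : ∃ δ, δ = min (d / N) (b / 16 / (M * M + M * N * M + N * M)) := ⟨_, rfl⟩
  have hM0 : 0 < M := by linarith
  have hδ0 : 0 < δ := by rw [hδ]; positivity
  have hδ1 : δ * N ≤ d := by
    rw [← le_div_iff₀ hN0, hδ]; exact min_le_left _ _
  have hδ2 : δ * (M * M + M * N * M + N * M) ≤ b / 16 := by
    rw [← le_div_iff₀ (by positivity), hδ]; exact min_le_right _ _
  have hδ3 : δ ≤ 1 := by nlinarith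
  refine ⟨δ, hδ0, b / 16, by positivity, fun ξ η ζ M1 M2 M3 hξ hη h0 hr h1 h2 h3 => ?_⟩
  obtain ⟨hτ, hr', hK⟩ := hM η ζ hη h0 hr
  have hww := wt_le_wt_one a hη
  have hw := wt_pos a η
  have hint := wt_mul_le_interior a κ ω ρ hη ζ h
  rw [← hb] at hint
  have hmN : axCoef a ω ρ η ζ ^ 2 * wt a η ^ 2 + radCoef a κ η ^ 2 + d ≤ N := by
    have e1 : axCoef a ω ρ η ζ ^ 2 ≤ M ^ 2 := by rw [← sq_abs]; gcongr
    have e2 : radCoef a κ η ^ 2 ≤ M ^ 2 := by rw [← sq_abs (radCoef a κ η)]; gcongr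
    have e3 : axCoef a ω ρ η ζ ^ 2 * wt a η ^ 2 ≤ M ^ 2 * wt a 1 ^ 2 := by gcongr
    rw [hN]; linarith
  have hm0 : 0 ≤ axCoef a ω ρ η ζ ^ 2 * wt a η ^ 2 + radCoef a κ η ^ 2 + d := by positivity
  refine calibration_pointwise (r := radCoef a κ η) (b := b) (d := d) hw (wt_sq a η) rfl
    ?_ hint hb0.le ?_ h1 ?_
  · have e1 : |ξ| * (axCoef a ω ρ η ζ ^ 2 * wt a η ^ 2 + radCoef a κ η ^ 2 + d) ≤ d :=
      (mul_le_mul hξ hmN hm0 hδ0.le).trans hδ1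
    rw [← sq_abs, ← mul_pow]
    have e2 := pow_le_pow_left₀ (by positivity) e1 2
    nlinarith
  · exact (mul_le_mul_of_nonneg_right hww hd0.le).trans hd2
  · generalize axCoef a ω ρ η ζ ^ 2 * wt a η ^ 2 + radCoef a κ η ^ 2 + d = m at *
    generalize axCoef a ω ρ η ζ = τ at *
    generalize a * η / wt a η = K at *
    have hξ1 : |ξ| ≤ 1 := hξ.trans hδ3
    have e1 : |-a * τ * M2| ≤ M * M * δ := by
      rw [abs_mul, abs_mul, abs_neg]; gcongr
    have e2 : |ξ * a * m * K / 2 * M2| ≤ M * N * M * δ := by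
      rw [abs_mul, abs_div, abs_mul, abs_mul, abs_mul, abs_of_nonneg hm0]
      calc |ξ| * |a| * m * |K| / |2| * |M2| ≤ 1 * M * N * M / |2| * δ := by gcongr
        _ = M * N * M * δ / 2 := by norm_num; ring
        _ ≤ M * N * M * δ := by linarith [show 0 ≤ M * N * M * δ by positivity]
    have e3 : |m * K * M3 / 2| ≤ N * M * δ := by
      rw [abs_div, abs_mul, abs_mul, abs_of_nonneg hm0]
      calc m * |K| * |M3| / |2| ≤ N * M * δ / |2| := by gcongr
        _ = N * M * δ / 2 := by norm_num
        _ ≤ N * M * δ := by linarith [show 0 ≤ N * M * δ by positivity]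
    calc |(-a * τ + ξ * a * m * K / 2) * M2 - m * K * M3 / 2|
        = |(-a * τ * M2 + ξ * a * m * K / 2 * M2) - m * K * M3 / 2| := by congr 1; ring
      _ ≤ |-a * τ * M2 + ξ * a * m * K / 2 * M2| + |m * K * M3 / 2| := abs_sub _ _
      _ ≤ |-a * τ * M2| + |ξ * a * m * K / 2 * M2| + |m * K * M3 / 2| := by
          gcongr; exact abs_add_le _ _
      _ ≤ δ * (M * M + M * N * M + N * M) := by linarith
      _ ≤ b / 16 := hδ2

/-- The boundary term of the calibration on the lateral edge `y = 1` is bounded below by the one of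
the helicoid. -/
lemma exists_boundary_bound (hκ : 1 < κ * (Real.sinh κ / Real.cosh κ)) (M : ℝ) :
    ∃ δ > 0, ∀ ξ η τ Z ξz ηz : ℝ, |η - 1| ≤ δ → ξ ^ 2 + η ^ 2 = 1 → ξ * ξz + η * ηz = 0 →
      |ξz| ≤ δ → |τ| ≤ M → 1 / 2 ≤ Z →
      wtInt a 1 * Z ≤ (wtInt a η - ξ ^ 2 * frameCoef a κ η / 2) * Z +
        (ξ * (a * η / wt a η) + ξ ^ 2 * τ / 2) * ηz := by
  have hw1 := wt_pos a 1
  have hsq1 := wt_sq a 1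
  obtain ⟨b, hb⟩ : ∃ b, b = -wt a 1 / (1 + 1) - frameCoef a κ 1 / 2 := ⟨_, rfl⟩
  -- At (ξ, η) = (0, 1) the ξ² coefficient of the boundary term is, up to a positive factor, κ tanh
  -- κ - 1. This is where the Robin-type condition at the wall enters.
  have hb0 : 0 < b := by
    have : b = (κ * (Real.sinh κ / Real.cosh κ) - 1) / (2 * wt a 1 ^ 3) := by
      rw [hb, frameCoef, radCoef]
      simp only [mul_one]
      generalize Real.sinh κ / Real.cosh κ = t
      have e4 : wt a 1 ^ 4 = (1 + a ^ 2 * 1 ^ 2) ^ 2 := by rw [← hsq1]; ring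
      field_simp
      ring_nf at e4 hsq1 ⊢
      rw [e4, hsq1]
      ring
    rw [this]
    have : 0 < κ * (Real.sinh κ / Real.cosh κ) - 1 := by linarith
    positivity
  have hcont : ContinuousAt (fun η => -wt a 1 / (1 + η) - frameCoef a κ η / 2) 1 := by
    refine ContinuousAt.sub (ContinuousAt.div (by fun_prop) (by fun_prop) (by norm_num)) ?_
    exact (contDiff_frameCoef a κ (n := 0)).continuous.continuousAt.div_const 2
  obtain ⟨δ₁, hδ₁, h1⟩ := Metric.continuousAt_iff.1 hcont (b / 2) (by positivity)
  rw [← hb] at h1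
  obtain ⟨N, hN⟩ : ∃ N, N = |a| + |M| := ⟨_, rfl⟩
  have hN0 : 0 ≤ N := by rw [hN]; positivity
  obtain ⟨δ, hδ⟩ : ∃ δ, δ = min (min (δ₁ / 2) (1 / 2)) (b / 8 / (N + 1)) := ⟨_, rfl⟩
  have d0 : 0 < δ := by rw [hδ]; positivity
  have d1 : δ ≤ δ₁ / 2 := by rw [hδ]; exact (min_le_left _ _).trans (min_le_left _ _)
  have d2 : δ ≤ 1 / 2 := by rw [hδ]; exact (min_le_left _ _).trans (min_le_right _ _)
  have d3 : δ * (N + 1) ≤ b / 8 := by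
    rw [← le_div_iff₀ (by positivity), hδ]; exact min_le_right _ _
  refine ⟨δ, d0, fun ξ η τ Z ξz ηz hη hcirc htan hξz hτ hZ => ?_⟩
  have hηpos : 1 / 2 ≤ η := by have := (abs_le.1 hη).1; linarith
  have hηle : η ≤ 1 := by nlinarith [sq_nonneg ξ]
  have hξle : |ξ| ≤ 1 := by rw [← sq_le_one_iff_abs_le_one]; nlinarith
  have hW := wtInt_one_le a (by linarith) hηle
  have h2 : b / 2 ≤ -wt a 1 / (1 + η) - frameCoef a κ η / 2 := by
    have := h1 (x := η) (by rw [Real.dist_eq]; linarith)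
    rw [Real.dist_eq] at this
    linarith [(abs_lt.1 this).1]
  -- On the unit circle 1 - η = ξ²/(1 + η), so the loss in `wtInt` is of second order in ξ and
  -- competes with the `frameCoef` term.
  have h3 : ξ ^ 2 * (-wt a 1 / (1 + η)) = -(wt a 1 * (1 - η)) := by
    have : ξ ^ 2 = (1 - η) * (1 + η) := by linarith
    rw [this]; field_simp
  -- Tangency to the circle gives ηz = -ξ ξz/η, which turns the term linear in ξ into ξ² times a
  -- small quantity.
  have h4 : (ξ * (a * η / wt a η) + ξ ^ 2 * τ / 2) * ηz =
      -(ξ ^ 2 * ((a / wt a η + ξ * τ / (2 * η)) * ξz)) := by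
    have : ηz = -(ξ * ξz) / η := by
      rw [eq_div_iff (by linarith)]; linarith
    have hη0 : η ≠ 0 := by linarith
    have := wt_pos a η
    rw [‹ηz = _›]; field_simp
  have h5 : |(a / wt a η + ξ * τ / (2 * η)) * ξz| ≤ b / 8 := by
    have e1 : |a / wt a η| ≤ |a| := by
      rw [abs_div, abs_of_pos (wt_pos a η)]
      exact div_le_self (abs_nonneg _) (one_le_wt a η)
    have e2 : |ξ * τ / (2 * η)| ≤ |M| := by
      rw [abs_div, abs_mul, abs_of_pos (show 0 < 2 * η by linarith)]
      refine (div_le_self (by positivity) (by linarith)).trans ?_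
      calc |ξ| * |τ| ≤ 1 * |M| :=
            mul_le_mul hξle (hτ.trans (le_abs_self M)) (abs_nonneg _) zero_le_one
        _ = |M| := one_mul _
    calc |(a / wt a η + ξ * τ / (2 * η)) * ξz| = |a / wt a η + ξ * τ / (2 * η)| * |ξz| := abs_mul _ _
      _ ≤ (N + 1) * δ := by
          gcongr
          refine (abs_add_le _ _).trans ?_
          rw [hN]; linarith
      _ ≤ b / 8 := by linarith
  rw [h4]
  have h6 := (abs_le.1 h5).2
  generalize (a / wt a η + ξ * τ / (2 * η)) * ξz = e at h6 ⊢
  generalize frameCoef a κ η = c at h2 ⊢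
  have h7 : ξ ^ 2 * (b / 2) ≤ -(wt a 1 * (1 - η)) - ξ ^ 2 * c / 2 := by
    have := mul_le_mul_of_nonneg_left h2 (sq_nonneg ξ)
    rw [mul_sub, h3] at this
    linarith
  -- The gain is at least ξ²(b/2)Z ≥ ξ²b/4, which outweighs the error ξ²b/8.
  have h8 : 0 ≤ (wtInt a η - wtInt a 1 - ξ ^ 2 * c / 2 - ξ ^ 2 * (b / 2)) * (Z - 1 / 2) :=
    mul_nonneg (by linarith) (by linarith)
  have h9 : 0 ≤ ξ ^ 2 * (b / 2) * (Z - 1 / 2) := by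
    have : 0 ≤ Z - 1 / 2 := by linarith
    positivity
  nlinarith [mul_le_mul_of_nonneg_left h6 (sq_nonneg ξ), sq_nonneg ξ]

end

/-! ### Surfaces near the helicoid in rotating coordinates -/

/-- `(ξ, η, ζ)` are the coordinates, in the frame that rotates with the helicoid, of a surface
with the boundary conditions of a competitor that is `C¹`-close to the helicoid `(0, y, z)`. -/
structure NearHelicoid (ρ δ : ℝ) (ξ η ζ : ℝ × ℝ → ℝ) : Prop where
  contDiffOn_fst : ContDiffOn ℝ 2 ξ (rect ρ)
  contDiffOn_snd : ContDiffOn ℝ 2 η (rect ρ)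
  contDiffOn_trd : ContDiffOn ℝ 2 ζ (rect ρ)
  bottom : ∀ y ∈ Icc (-1 : ℝ) 1, ξ (y, 0) = 0 ∧ ζ (y, 0) = 0
  top : ∀ y ∈ Icc (-1 : ℝ) 1, ξ (y, ρ) = 0 ∧ ζ (y, ρ) = ρ
  side : ∀ y ∈ ({-1, 1} : Set ℝ), ∀ z ∈ Icc 0 ρ, ξ (y, z) ^ 2 + η (y, z) ^ 2 = 1
  abs_fst : ∀ p ∈ rect ρ, |ξ p| ≤ δ
  abs_snd : ∀ p ∈ rect ρ, |η p - p.1| ≤ δ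
  abs_pdy_fst : ∀ p ∈ rect ρ, |pdy ρ ξ p| ≤ δ
  abs_pdz_fst : ∀ p ∈ rect ρ, |pdz ρ ξ p| ≤ δ
  abs_pdy_snd : ∀ p ∈ rect ρ, |pdy ρ η p - 1| ≤ δ
  abs_pdz_snd : ∀ p ∈ rect ρ, |pdz ρ η p| ≤ δ
  abs_pdy_trd : ∀ p ∈ rect ρ, |pdy ρ ζ p| ≤ δ
  abs_pdz_trd : ∀ p ∈ rect ρ, |pdz ρ ζ p - 1| ≤ δ

namespace NearHelicoid
variable {ρ δ : ℝ} {ξ η ζ : ℝ × ℝ → ℝ}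

lemma mono {δ' : ℝ} (h : NearHelicoid ρ δ ξ η ζ) (hδ : δ ≤ δ') : NearHelicoid ρ δ' ξ η ζ where
  __ := h
  abs_fst p hp := (h.abs_fst p hp).trans hδ
  abs_snd p hp := (h.abs_snd p hp).trans hδ
  abs_pdy_fst p hp := (h.abs_pdy_fst p hp).trans hδ
  abs_pdz_fst p hp := (h.abs_pdz_fst p hp).trans hδ
  abs_pdy_snd p hp := (h.abs_pdy_snd p hp).trans hδ
  abs_pdz_snd p hp := (h.abs_pdz_snd p hp).trans hδ
  abs_pdy_trd p hp := (h.abs_pdy_trd p hp).trans hδ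
  abs_pdz_trd p hp := (h.abs_pdz_trd p hp).trans hδ

/-- ζ increases along each vertical segment, between its prescribed values on the wires. Thus the
cosine behind `axCoef` stays positive. -/
lemma trd_mem (h : NearHelicoid ρ δ ξ η ζ) (hρ : 0 < ρ) (hδ : δ ≤ 1 / 8) {p : ℝ × ℝ}
    (hp : p ∈ rect ρ) : 0 ≤ ζ p ∧ ζ p ≤ ρ := by
  obtain ⟨y, z⟩ := p
  have hy : y ∈ Icc (-1 : ℝ) 1 := hp.1
  have hz : z ∈ Icc 0 ρ := hp.2
  have hd : DifferentiableOn ℝ ζ (rect ρ) := h.contDiffOn_trd.differentiableOn (by norm_num)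
  have hmono : MonotoneOn (fun z => ζ (y, z)) (Icc 0 ρ) := by
    refine monotoneOn_of_hasDerivWithinAt_nonneg (convex_Icc 0 ρ)
      (f' := fun z => pdz ρ ζ (y, z))
      (fun t ht => (hasDerivWithinAt_pdz hd hy ht).continuousWithinAt)
      (fun t ht => (hasDerivWithinAt_pdz hd hy (interior_subset ht)).mono interior_subset) ?_
    intro t ht
    have := (abs_le.1 (h.abs_pdz_trd (y, t) ⟨hy, interior_subset ht⟩)).1
    linarith
  have h0 := hmono (left_mem_Icc.2 hρ.le) hz hz.1
  have h1 := hmono hz (right_mem_Icc.2 hρ.le) hz.2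
  simp only [(h.bottom y hy).2, (h.top y hy).2] at h0 h1
  exact ⟨h0, h1⟩

/-- Competitors are not assumed to lie inside the tube, but C¹-closeness forces it: near each
lateral edge ξ² + η² increases towards the edge, where it equals 1, and for |y| ≤ 1/2 it is small
anyway. -/
lemma sq_add_sq_le (h : NearHelicoid ρ δ ξ η ζ) (hδ : δ ≤ 1 / 8) {p : ℝ × ℝ}
    (hp : p ∈ rect ρ) : ξ p ^ 2 + η p ^ 2 ≤ 1 := by
  obtain ⟨y, z⟩ := p
  have hy : y ∈ Icc (-1 : ℝ) 1 := hp.1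
  have hz : z ∈ Icc 0 ρ := hp.2
  have hdξ : DifferentiableOn ℝ ξ (rect ρ) := h.contDiffOn_fst.differentiableOn (by norm_num)
  have hdη : DifferentiableOn ℝ η (rect ρ) := h.contDiffOn_snd.differentiableOn (by norm_num)
  have hder : ∀ t ∈ Icc (-1 : ℝ) 1, HasDerivWithinAt (fun y => ξ (y, z) ^ 2 + η (y, z) ^ 2)
      (2 * (ξ (t, z) * pdy ρ ξ (t, z) + η (t, z) * pdy ρ η (t, z))) (Icc (-1) 1) t := by
    intro t ht
    refine (((hasDerivWithinAt_pdy hdξ ht hz).pow 2).add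
      ((hasDerivWithinAt_pdy hdη ht hz).pow 2)).congr_deriv ?_
    simp only [pdy]; push_cast; ring
  have bd : ∀ t ∈ Icc (-1 : ℝ) 1, |ξ (t, z) * pdy ρ ξ (t, z)| ≤ 1 / 64 ∧
      |η (t, z) - t| ≤ 1 / 8 ∧ |pdy ρ η (t, z) - 1| ≤ 1 / 8 := by
    intro t ht
    have hm : (t, z) ∈ rect ρ := ⟨ht, hz⟩
    refine ⟨?_, (h.abs_snd _ hm).trans hδ, (h.abs_pdy_snd _ hm).trans hδ⟩
    rw [abs_mul]
    calc |ξ (t, z)| * |pdy ρ ξ (t, z)| ≤ 1 / 8 * (1 / 8) :=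
          mul_le_mul ((h.abs_fst _ hm).trans hδ) ((h.abs_pdy_fst _ hm).trans hδ)
            (abs_nonneg _) (by norm_num)
      _ = 1 / 64 := by norm_num
  rcases le_total y (1 / 2) with h1 | h1
  · rcases le_total (-(1 / 2)) y with h2 | h2
    · have e1 := (h.abs_fst _ hp).trans hδ
      have e2 := (h.abs_snd _ hp).trans hδ
      rw [abs_le] at e1 e2
      have e3 : -(5 / 8) ≤ η (y, z) := by simp only at e2; linarith
      have e4 : η (y, z) ≤ 5 / 8 := by simp only at e2; linarith
      nlinarith
    · have hanti : AntitoneOn (fun y => ξ (y, z) ^ 2 + η (y, z) ^ 2) (Icc (-1) (-(1 / 2))) := by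
        have hs : Icc (-1 : ℝ) (-(1 / 2)) ⊆ Icc (-1) 1 := Icc_subset_Icc le_rfl (by norm_num)
        refine antitoneOn_of_hasDerivWithinAt_nonpos (convex_Icc _ _)
          (fun t ht => ((hder t (hs ht)).mono hs).continuousWithinAt)
          (fun t ht => (hder t (hs (interior_subset ht))).mono (interior_subset.trans hs)) ?_
        intro t ht
        have ht' := interior_subset ht
        obtain ⟨b1, b2, b3⟩ := bd t (hs ht')
        rw [abs_le] at b1 b2 b3
        nlinarith [ht'.1, ht'.2]
      have := hanti (left_mem_Icc.2 (by norm_num)) ⟨hy.1, h2⟩ hy.1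
      simp only [h.side (-1) (by simp) z hz] at this
      exact this
  · have hmono : MonotoneOn (fun y => ξ (y, z) ^ 2 + η (y, z) ^ 2) (Icc (1 / 2) 1) := by
      have hs : Icc (1 / 2 : ℝ) 1 ⊆ Icc (-1) 1 := Icc_subset_Icc (by norm_num) le_rfl
      refine monotoneOn_of_hasDerivWithinAt_nonneg (convex_Icc _ _)
        (fun t ht => ((hder t (hs ht)).mono hs).continuousWithinAt)
        (fun t ht => (hder t (hs (interior_subset ht))).mono (interior_subset.trans hs)) ?_
      intro t ht
      have ht' := interior_subset ht
      obtain ⟨b1, b2, b3⟩ := bd t (hs ht')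
      rw [abs_le] at b1 b2 b3
      nlinarith [ht'.1, ht'.2]
    have := hmono ⟨h1, hy.2⟩ (right_mem_Icc.2 (by norm_num)) hy.2
    simp only [h.side 1 (by simp) z hz] at this
    exact this

lemma abs_snd_le_one (h : NearHelicoid ρ δ ξ η ζ) (hδ : δ ≤ 1 / 8) {p : ℝ × ℝ}
    (hp : p ∈ rect ρ) : |η p| ≤ 1 := by
  have := h.sq_add_sq_le hδ hp
  rw [← sq_le_one_iff_abs_le_one]
  nlinarith [sq_nonneg (ξ p)]

lemma jac_snd_trd (h : NearHelicoid ρ δ ξ η ζ) (hδ : δ ≤ 1 / 8) {p : ℝ × ℝ}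
    (hp : p ∈ rect ρ) : 1 / 2 ≤ jac ρ η ζ p := by
  have e1 := (h.abs_pdy_snd p hp).trans hδ
  have e2 := (h.abs_pdz_snd p hp).trans hδ
  have e3 := (h.abs_pdy_trd p hp).trans hδ
  have e4 := (h.abs_pdz_trd p hp).trans hδ
  have e5 : |pdz ρ η p * pdy ρ ζ p| ≤ 1 / 8 * (1 / 8) := by
    rw [abs_mul]; exact mul_le_mul e2 e3 (abs_nonneg _) (by norm_num)
  rw [abs_le] at e1 e4 e5
  unfold jac
  nlinarith

lemma abs_jac_trd_fst (h : NearHelicoid ρ δ ξ η ζ) (hδ : δ ≤ 1 / 8) {p : ℝ × ℝ}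
    (hp : p ∈ rect ρ) : |jac ρ ζ ξ p| ≤ 4 * δ := by
  have e1 := h.abs_pdy_fst p hp
  have e2 := h.abs_pdz_fst p hp
  have e3 := (h.abs_pdy_trd p hp).trans hδ
  have e4 := (h.abs_pdz_trd p hp).trans hδ
  have e5 : |pdz ρ ζ p| ≤ 2 := by rw [abs_le] at e4 ⊢; constructor <;> linarith
  have : 0 ≤ δ := (abs_nonneg _).trans e1
  unfold jac
  refine (abs_sub _ _).trans ?_
  rw [abs_mul, abs_mul]
  have f1 := mul_le_mul e3 e2 (abs_nonneg _) (by norm_num)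
  have f2 := mul_le_mul e5 e1 (abs_nonneg _) (by norm_num)
  linarith

lemma abs_jac_fst_snd (h : NearHelicoid ρ δ ξ η ζ) (hδ : δ ≤ 1 / 8) {p : ℝ × ℝ}
    (hp : p ∈ rect ρ) : |jac ρ ξ η p| ≤ 4 * δ := by
  have e1 := h.abs_pdy_fst p hp
  have e2 := h.abs_pdz_fst p hp
  have e3 := (h.abs_pdz_snd p hp).trans hδ
  have e4 := (h.abs_pdy_snd p hp).trans hδ
  have e5 : |pdy ρ η p| ≤ 2 := by rw [abs_le] at e4 ⊢; constructor <;> linarith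
  have : 0 ≤ δ := (abs_nonneg _).trans e1
  unfold jac
  refine (abs_sub _ _).trans ?_
  rw [abs_mul, abs_mul]
  have f1 := mul_le_mul e1 e3 (abs_nonneg _) this
  have f2 := mul_le_mul e2 e5 (abs_nonneg _) this
  linarith

end NearHelicoid

/-! ### The calibrating form and Stokes' theorem -/

section
variable {ρ : ℝ} {ξ η ζ : ℝ × ℝ → ℝ}

lemma jac_axial_form (hρ : 0 < ρ) (a κ : ℝ) {p : ℝ × ℝ} (hp : p ∈ rect ρ)
    (hξ : DifferentiableWithinAt ℝ ξ (rect ρ) p) (hη : DifferentiableWithinAt ℝ η (rect ρ) p) :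
    jac ρ (fun p => wtInt a (η p) - ξ p ^ 2 * frameCoef a κ (η p) / 2) ζ p =
      wt a (η p) * jac ρ η ζ p + ξ p * frameCoef a κ (η p) * jac ρ ζ ξ p -
        ξ p ^ 2 * frameCoefDeriv a κ (η p) * jac ρ η ζ p / 2 := by
  have hu := uniqueDiffOn_rect hρ p hp
  have h1 := (hasDerivAt_wtInt a (η p)).comp_hasFDerivWithinAt p hη.hasFDerivWithinAt
  have h2 := (hasDerivAt_frameCoef a κ (η p)).comp_hasFDerivWithinAt p hη.hasFDerivWithinAt
  have h3 := h1.sub (((hξ.hasFDerivWithinAt.pow 2).mul h2).mul_const (1 / 2 : ℝ))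
  have h4 : HasFDerivWithinAt
    (fun p => wtInt a (η p) - ξ p ^ 2 * frameCoef a κ (η p) / 2) _ (rect ρ) p :=
    HasFDerivWithinAt.congr' h3 (fun q _ => by simp; ring) hp
  have h5 := h4.fderivWithin hu
  unfold jac pdy pdz
  rw [h5]
  simp
  ring

/-- Since dη ∧ dη = 0, the η-derivatives of the coefficients drop out; only the derivatives in ξ and
ζ survive. -/
lemma jac_radial_form (hρ : 0 < ρ) (a : ℝ) {ω : ℝ} (hω : 0 < ω) (hωρ : ω * ρ < Real.pi)
    {p : ℝ × ℝ} (hp : p ∈ rect ρ)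
    (hξ : DifferentiableWithinAt ℝ ξ (rect ρ) p) (hη : DifferentiableWithinAt ℝ η (rect ρ) p)
    (hζ : DifferentiableWithinAt ℝ ζ (rect ρ) p) (h0 : 0 ≤ ζ p) (h1 : ζ p ≤ ρ) :
    jac ρ (fun p => ξ p * (a * η p / wt a (η p)) + ξ p ^ 2 * axCoef a ω ρ (η p) (ζ p) / 2) η p =
      a * η p / wt a (η p) * jac ρ ξ η p + ξ p * axCoef a ω ρ (η p) (ζ p) * jac ρ ξ η p -
        ξ p ^ 2 * axCoefDeriv a ω ρ (η p) (ζ p) * jac ρ η ζ p / 2 := by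
  have hu := uniqueDiffOn_rect hρ p hp
  have hK : HasDerivAt (fun t => a * t / wt a t) _ (η p) :=
    ((contDiff_angCoef a (n := 1)).differentiable (by norm_num) (η p)).hasDerivAt
  have hW : HasDerivAt (fun t => (wt a t ^ 3)⁻¹) _ (η p) :=
    ((((contDiff_wt a (n := 1)).differentiable (by norm_num) (η p)).pow 3).inv
      (pow_ne_zero 3 (wt_pos a _).ne')).hasDerivAt
  have k1 := hK.comp_hasFDerivWithinAt p hη.hasFDerivWithinAt
  have k2 := hW.comp_hasFDerivWithinAt p hη.hasFDerivWithinAt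
  have k3 := (hasDerivAt_tan_axial hω hωρ h0 h1).comp_hasFDerivWithinAt p hζ.hasFDerivWithinAt
  have h3 := (hξ.hasFDerivWithinAt.mul k1).add
    (((hξ.hasFDerivWithinAt.pow 2).mul (k3.mul k2)).mul_const (1 / 2 : ℝ))
  have h4 : HasFDerivWithinAt (fun p => ξ p * (a * η p / wt a (η p)) +
      ξ p ^ 2 * axCoef a ω ρ (η p) (ζ p) / 2) _ (rect ρ) p :=
    HasFDerivWithinAt.congr' h3 (fun q _ => by simp [axCoef]; ring) hp
  have h5 := h4.fderivWithin hu
  unfold jac pdy pdz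
  rw [h5]
  simp only [axCoef, axCoefDeriv]
  simp
  ring

end

lemma deriv_eq_zero_of_eq_const {a b c f' t : ℝ} {f : ℝ → ℝ} (hab : a < b)
    (hf : ∀ s ∈ Icc a b, f s = c) (ht : t ∈ Icc a b) (hd : HasDerivWithinAt f f' (Icc a b) t) :
    f' = 0 :=
  (uniqueDiffOn_Icc hab t ht).eq_deriv _ hd
    ((hasDerivWithinAt_const t (Icc a b) c).congr_of_mem hf ht)

lemma continuousOn_vert {ρ y : ℝ} {F : ℝ × ℝ → ℝ} (hF : ContinuousOn F (rect ρ))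
    (hy : y ∈ Icc (-1 : ℝ) 1) : ContinuousOn (fun z => F (y, z)) (Icc 0 ρ) :=
  hF.comp (by fun_prop) fun _ hz => mem_prod.2 ⟨hy, hz⟩

lemma contDiffOn_axCoef_comp {a ω ρ : ℝ} (hω : 0 < ω) (hωρ : ω * ρ < Real.pi)
    {η ζ : ℝ × ℝ → ℝ} {s : Set (ℝ × ℝ)} (hη : ContDiffOn ℝ 1 η s) (hζ : ContDiffOn ℝ 1 ζ s)
    (h : ∀ p ∈ s, 0 ≤ ζ p ∧ ζ p ≤ ρ) :
    ContDiffOn ℝ 1 (fun p => axCoef a ω ρ (η p) (ζ p)) s := by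
  unfold axCoef
  refine ContDiffOn.div (contDiffOn_const.mul fun p hp => ?_)
    (((contDiff_wt a (n := 1)).comp_contDiffOn hη).pow 3) fun p _ => pow_ne_zero 3 (wt_pos a _).ne'
  have hc := (cos_axial_pos hω hωρ (h p hp).1 (h p hp).2).ne'
  exact ContDiffAt.comp_contDiffWithinAt (g := Real.tan) p (Real.contDiffAt_tan.2 hc)
    ((contDiffOn_const.mul (hζ.sub contDiffOn_const)) p hp)

/-- The quantitative calibration inequality: the area of a surface close to the helicoid exceeds
the area of the helicoid by a multiple of the squared distance. -/
theorem exists_area_lower_bound {a κ ω ρ : ℝ} (hρ : 0 < ρ) (hω : 0 < ω) (hωρ : ω * ρ < Real.pi)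
    (h : 0 < ω ^ 2 - 2 * a ^ 2 - κ ^ 2) (hκ : 1 < κ * (Real.sinh κ / Real.cosh κ)) :
    ∃ δ > 0, ∃ c > 0, ∀ ξ η ζ, NearHelicoid ρ δ ξ η ζ →
      2 * ρ * wtInt a 1 + c * ∫ p in rect ρ, ξ p ^ 2 ≤
      ∫ p in rect ρ, Real.sqrt (jac ρ η ζ p ^ 2 + jac ρ ζ ξ p ^ 2 +
        (jac ρ ξ η p - a * ξ p * jac ρ ζ ξ p + a * η p * jac ρ η ζ p) ^ 2) := by
  obtain ⟨δ₁, hδ₁, c, hc, hin⟩ := exists_interior_bound hρ hω hωρ h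
  obtain ⟨M, -, -, hM⟩ := exists_coef_bound (a := a) (κ := κ) hρ hω hωρ
  obtain ⟨δ₂, hδ₂, hbd⟩ := exists_boundary_bound (a := a) hκ M
  refine ⟨min (min (δ₁ / 4) δ₂) (1 / 8), by positivity, c, hc, fun ξ η ζ hN => ?_⟩
  generalize hδ : min (min (δ₁ / 4) δ₂) (1 / 8) = δ at hN
  have hd1 : 4 * δ ≤ δ₁ := by
    have : δ ≤ δ₁ / 4 := by rw [← hδ]; exact (min_le_left _ _).trans (min_le_left _ _)
    linarith
  have hd2 : δ ≤ δ₂ := by rw [← hδ]; exact (min_le_left _ _).trans (min_le_right _ _)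
  have hd3 : δ ≤ 1 / 8 := by rw [← hδ]; exact min_le_right _ _
  have hζmem : ∀ p ∈ rect ρ, 0 ≤ ζ p ∧ ζ p ≤ ρ := fun p hp => hN.trd_mem hρ hd3 hp
  have cξ := hN.contDiffOn_fst.of_le (show (1 : WithTop ℕ∞) ≤ 2 by norm_num)
  have cη := hN.contDiffOn_snd.of_le (show (1 : WithTop ℕ∞) ≤ 2 by norm_num)
  have cζ := hN.contDiffOn_trd.of_le (show (1 : WithTop ℕ∞) ≤ 2 by norm_num)
  have dξ := cξ.differentiableOn (by norm_num)
  have dη := cη.differentiableOn (by norm_num)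
  have dζ := cζ.differentiableOn (by norm_num)
  -- Potentials of the calibrating form dG ∧ dζ + dH ∧ dη; exactness is what lets Stokes reduce it
  -- to the edges.
  set G : ℝ × ℝ → ℝ := fun p => wtInt a (η p) - ξ p ^ 2 * frameCoef a κ (η p) / 2 with hG
  set H : ℝ × ℝ → ℝ := fun p =>
    ξ p * (a * η p / wt a (η p)) + ξ p ^ 2 * axCoef a ω ρ (η p) (ζ p) / 2 with hH
  have cG : ContDiffOn ℝ 1 G (rect ρ) :=
    ((contDiff_wtInt a).comp_contDiffOn cη).sub
      (((cξ.pow 2).mul ((contDiff_frameCoef a κ (n := 1)).comp_contDiffOn cη)).div_const 2)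
  have cH : ContDiffOn ℝ 1 H (rect ρ) :=
    (cξ.mul ((contDiff_angCoef a (n := 1)).comp_contDiffOn cη)).add
      (((cξ.pow 2).mul (contDiffOn_axCoef_comp hω hωρ cη cζ hζmem)).div_const 2)
  have jξη := continuousOn_jac hρ cξ cη
  have jζξ := continuousOn_jac hρ cζ cξ
  have jηζ := continuousOn_jac hρ cη cζ
  have hcξ := cξ.continuousOn
  have hcη := cη.continuousOn
  have ihξ : IntegrableOn (fun p => c * ξ p ^ 2) (rect ρ) :=
    integrableOn_rect (continuousOn_const.mul (hcξ.pow 2))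
  have iG : IntegrableOn (jac ρ G ζ) (rect ρ) := integrableOn_rect (continuousOn_jac hρ cG cζ)
  have iH : IntegrableOn (jac ρ H η) (rect ρ) := integrableOn_rect (continuousOn_jac hρ cH cη)
  have hpoint : ∫ p in rect ρ, (jac ρ G ζ p + jac ρ H η p + c * ξ p ^ 2) ≤
      ∫ p in rect ρ, Real.sqrt (jac ρ η ζ p ^ 2 + jac ρ ζ ξ p ^ 2 +
        (jac ρ ξ η p - a * ξ p * jac ρ ζ ξ p + a * η p * jac ρ η ζ p) ^ 2) := by
    refine setIntegral_mono_on ((iG.add iH).add ihξ) ?_ (measurableSet_rect ρ) fun p hp => ?_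
    · refine integrableOn_rect (ContinuousOn.sqrt ?_)
      exact ((jηζ.pow 2).add (jζξ.pow 2)).add (((jξη.sub ((continuousOn_const.mul hcξ).mul jζξ)).add
        ((continuousOn_const.mul hcη).mul jηζ)).pow 2)
    · have hz := hζmem p hp
      rw [hG, hH, jac_axial_form hρ a κ hp (dξ p hp) (dη p hp),
        jac_radial_form hρ a hω hωρ hp (dξ p hp) (dη p hp) (dζ p hp) hz.1 hz.2]
      have := hin (ξ p) (η p) (ζ p) (jac ρ η ζ p) (jac ρ ζ ξ p) (jac ρ ξ η p)
        ((hN.abs_fst p hp).trans (by linarith [(abs_nonneg (ξ p)).trans (hN.abs_fst p hp)]))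
        (hN.abs_snd_le_one hd3 hp) hz.1 hz.2
        (hN.jac_snd_trd hd3 hp) ((hN.abs_jac_trd_fst hd3 hp).trans hd1)
        ((hN.abs_jac_fst_snd hd3 hp).trans hd1)
      linarith
  refine le_trans ?_ hpoint
  have hsplit : ∫ p in rect ρ, (jac ρ G ζ p + jac ρ H η p + c * ξ p ^ 2) =
      (∫ p in rect ρ, jac ρ G ζ p) + (∫ p in rect ρ, jac ρ H η p) +
        c * ∫ p in rect ρ, ξ p ^ 2 := by
    have e := integral_add (iG.add iH) ihξ
    simp only [Pi.add_apply] at e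
    rw [e, integral_add iG iH, integral_const_mul]
  rw [hsplit]
  gcongr
  -- On the wire edges ζ is constant, so dζ vanishes along them, and H vanishes with ξ.
  have wire : ∀ z ∈ ({0, ρ} : Set ℝ), (∫ y in (-1 : ℝ)..1, G (y, z) * pdy ρ ζ (y, z)) = 0 ∧
      (∫ y in (-1 : ℝ)..1, H (y, z) * pdy ρ η (y, z)) = 0 := by
    intro z hz
    have hz' : z ∈ Icc 0 ρ := by
      rcases hz with rfl | hz
      · exact left_mem_Icc.2 hρ.le
      · rw [hz]; exact right_mem_Icc.2 hρ.le
    have hval : ∀ y ∈ Icc (-1 : ℝ) 1, ξ (y, z) = 0 ∧ ζ (y, z) = z := by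
      intro y hy
      rcases hz with rfl | hz
      · exact hN.bottom y hy
      · rw [hz]; exact hN.top y hy
    have huI : uIcc (-1 : ℝ) 1 = Icc (-1) 1 := uIcc_of_le (by norm_num)
    constructor
    · rw [← intervalIntegral.integral_zero (a := (-1 : ℝ)) (b := 1)]
      refine intervalIntegral.integral_congr fun y hy => ?_
      rw [huI] at hy
      have : pdy ρ ζ (y, z) = 0 := deriv_eq_zero_of_eq_const (by norm_num)
        (fun s hs => (hval s hs).2) hy (hasDerivWithinAt_pdy dζ hy hz')
      simp [this]
    · rw [← intervalIntegral.integral_zero (a := (-1 : ℝ)) (b := 1)]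
      refine intervalIntegral.integral_congr fun y hy => ?_
      rw [huI] at hy
      simp [hH, (hval y hy).1]
  have hw0 := wire 0 (by simp)
  have hwρ := wire ρ (by simp)
  rw [integral_jac hρ cG hN.contDiffOn_trd, integral_jac hρ cH hN.contDiffOn_snd,
    hw0.1, hw0.2, hwρ.1, hwρ.2]
  have m1 : (1 : ℝ) ∈ Icc (-1 : ℝ) 1 := by norm_num
  have m2 : (-1 : ℝ) ∈ Icc (-1 : ℝ) 1 := by norm_num
  have ii : ∀ {F : ℝ → ℝ}, ContinuousOn F (Icc 0 ρ) → IntervalIntegrable F volume 0 ρ :=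
    fun hF => ContinuousOn.intervalIntegrable (by rwa [uIcc_of_le hρ.le])
  have zz := continuousOn_pdz hρ cζ
  have zη := continuousOn_pdz hρ cη
  have hGH : ∀ y ∈ Icc (-1 : ℝ) 1,
      (∫ z in (0 : ℝ)..ρ, G (y, z) * pdz ρ ζ (y, z)) + (∫ z in (0 : ℝ)..ρ, H (y, z) * pdz ρ η (y, z)) =
      ∫ z in (0 : ℝ)..ρ, (G (y, z) * pdz ρ ζ (y, z) + H (y, z) * pdz ρ η (y, z)) := by
    intro y hy
    refine (intervalIntegral.integral_add (ii ?_) (ii ?_)).symm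
    · exact continuousOn_vert (cG.continuousOn.mul zz) hy
    · exact continuousOn_vert (cH.continuousOn.mul zη) hy
  have hgrow : ∀ y ∈ Icc (-1 : ℝ) 1, (∫ z in (0 : ℝ)..ρ, wtInt a 1 * pdz ρ ζ (y, z)) =
      wtInt a 1 * ρ := by
    intro y hy
    rw [intervalIntegral.integral_const_mul, intervalIntegral.integral_eq_sub_of_hasDerivAt_of_le
      (f' := fun z => pdz ρ ζ (y, z)) hρ.le (continuousOn_vert cζ.continuousOn hy) (fun z hz =>
        (hasDerivWithinAt_pdz dζ hy (Ioo_subset_Icc_self hz)).hasDerivAt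
          (Icc_mem_nhds hz.1 hz.2)) (ii (continuousOn_vert zz hy)), (hN.top y hy).2,
      (hN.bottom y hy).2, sub_zero]
  have htan : ∀ y ∈ ({-1, 1} : Set ℝ), ∀ z ∈ Icc 0 ρ,
      ξ (y, z) * pdz ρ ξ (y, z) + η (y, z) * pdz ρ η (y, z) = 0 := by
    intro y hy z hz
    have hy' : y ∈ Icc (-1 : ℝ) 1 := by
      rcases hy with rfl | hy
      · exact m2
      · rw [hy]; exact m1
    have := deriv_eq_zero_of_eq_const hρ (hN.side y hy) hz
      (((hasDerivWithinAt_pdz dξ hy' hz).pow 2).add ((hasDerivWithinAt_pdz dη hy' hz).pow 2))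
    simp only [pdz]
    push_cast at this
    linarith
  have right : wtInt a 1 * ρ ≤
      ∫ z in (0 : ℝ)..ρ, (G (1, z) * pdz ρ ζ (1, z) + H (1, z) * pdz ρ η (1, z)) := by
    rw [← hgrow 1 m1]
    refine intervalIntegral.integral_mono_on hρ.le (ii ?_) (ii ?_) fun z hz => ?_
    · exact continuousOn_vert (continuousOn_const.mul zz) m1
    · exact continuousOn_vert ((cG.continuousOn.mul zz).add (cH.continuousOn.mul zη)) m1
    · have hp : ((1 : ℝ), z) ∈ rect ρ := ⟨m1, hz⟩
      have hzz := hζmem _ hp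
      have e1 := (abs_le.1 ((hN.abs_pdz_trd _ hp).trans hd3)).1
      exact hbd (ξ (1, z)) (η (1, z)) (axCoef a ω ρ (η (1, z)) (ζ (1, z))) (pdz ρ ζ (1, z))
        (pdz ρ ξ (1, z)) (pdz ρ η (1, z)) ((hN.abs_snd _ hp).trans hd2)
        (hN.side 1 (by simp) z hz) (htan 1 (by simp) z hz) ((hN.abs_pdz_fst _ hp).trans hd2)
        (hM _ _ (hN.abs_snd_le_one hd3 hp) hzz.1 hzz.2).1 (by linarith)
  have left : wtInt a 1 * ρ ≤
      -∫ z in (0 : ℝ)..ρ, (G (-1, z) * pdz ρ ζ (-1, z) + H (-1, z) * pdz ρ η (-1, z)) := by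
    rw [← hgrow (-1) m2, ← intervalIntegral.integral_neg]
    refine intervalIntegral.integral_mono_on hρ.le (ii ?_) (ii ?_) fun z hz => ?_
    · exact continuousOn_vert (continuousOn_const.mul zz) m2
    · exact continuousOn_vert ((cG.continuousOn.mul zz).add (cH.continuousOn.mul zη)).neg m2
    · have hp : ((-1 : ℝ), z) ∈ rect ρ := ⟨m2, hz⟩
      have hzz := hζmem _ hp
      have e1 := (abs_le.1 ((hN.abs_pdz_trd _ hp).trans hd3)).1
      have e2 := hN.side (-1) (by simp) z hz
      have e3 := htan (-1) (by simp) z hz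
      -- The half-turn (ξ, η) ↦ (-ξ, -η) brings this edge to the situation near η = 1.
      have := hbd (-ξ (-1, z)) (-η (-1, z)) (axCoef a ω ρ (η (-1, z)) (ζ (-1, z)))
        (pdz ρ ζ (-1, z)) (-pdz ρ ξ (-1, z)) (-pdz ρ η (-1, z))
        (by
          rw [show -η (-1, z) - 1 = -(η (-1, z) - (-1)) by ring, abs_neg]
          exact (hN.abs_snd _ hp).trans hd2)
        (by linarith) (by linarith) (by rw [abs_neg]; exact (hN.abs_pdz_fst _ hp).trans hd2)
        (hM _ _ (hN.abs_snd_le_one hd3 hp) hzz.1 hzz.2).1 (by linarith)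
      rw [wtInt_neg, frameCoef_neg, wt_neg] at this
      refine this.trans (le_of_eq ?_)
      simp only [hG, hH]
      ring
  have g1 := hGH 1 m1
  have g2 := hGH (-1) m2
  linarith

/-! ### The rotating frame -/

/-- The coordinate transverse to the helicoid of pitch `a`, in the rotating frame. -/
noncomputable def frameFst (a : ℝ) (x : E3) : ℝ := x 0 * Real.cos (a * x 2) + x 1 * Real.sin (a * x 2)

/-- The coordinate along the rulings of the helicoid of pitch `a`, in the rotating frame. -/
noncomputable def frameSnd (a : ℝ) (x : E3) : ℝ := -x 0 * Real.sin (a * x 2) + x 1 * Real.cos (a * x 2)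

/-- The height. -/
def frameTrd (x : E3) : ℝ := x 2

lemma contDiff_coord (i : Fin 3) : ContDiff ℝ 2 (fun x : E3 => x i) :=
  (EuclideanSpace.proj (𝕜 := ℝ) i).contDiff

lemma contDiff_frameFst (a : ℝ) : ContDiff ℝ 2 (frameFst a) := by
  have h0 := contDiff_coord 0
  have h1 := contDiff_coord 1
  have h2 := contDiff_coord 2
  exact (h0.mul (contDiff_const.mul h2).cos).add (h1.mul (contDiff_const.mul h2).sin)

lemma contDiff_frameSnd (a : ℝ) : ContDiff ℝ 2 (frameSnd a) := by
  have h0 := contDiff_coord 0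
  have h1 := contDiff_coord 1
  have h2 := contDiff_coord 2
  exact (h0.neg.mul (contDiff_const.mul h2).sin).add (h1.mul (contDiff_const.mul h2).cos)

lemma contDiff_frameTrd : ContDiff ℝ 2 frameTrd := contDiff_coord 2

lemma frame_sq_add_sq (a : ℝ) (x : E3) :
    frameFst a x ^ 2 + frameSnd a x ^ 2 = x 0 ^ 2 + x 1 ^ 2 := by
  have := Real.sin_sq_add_cos_sq (a * x 2)
  unfold frameFst frameSnd
  linear_combination (x 0 ^ 2 + x 1 ^ 2) * this

section
variable {ρ θ : ℝ}

lemma helicoid_apply (p : ℝ × ℝ) : helicoid ρ θ p 0 = -p.1 * Real.sin (θ * p.2 / ρ) ∧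
    helicoid ρ θ p 1 = p.1 * Real.cos (θ * p.2 / ρ) ∧ helicoid ρ θ p 2 = p.2 := by
  simp [helicoid]

lemma frameFst_helicoid (p : ℝ × ℝ) : frameFst (θ / ρ) (helicoid ρ θ p) = 0 := by
  obtain ⟨h0, h1, h2⟩ := helicoid_apply (ρ := ρ) (θ := θ) p
  rw [frameFst, h0, h1, h2, div_mul_eq_mul_div]
  ring

lemma frameSnd_helicoid (p : ℝ × ℝ) : frameSnd (θ / ρ) (helicoid ρ θ p) = p.1 := by
  obtain ⟨h0, h1, h2⟩ := helicoid_apply (ρ := ρ) (θ := θ) p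
  rw [frameSnd, h0, h1, h2, div_mul_eq_mul_div]
  linear_combination p.1 * Real.sin_sq_add_cos_sq (θ * p.2 / ρ)

lemma frameTrd_helicoid (p : ℝ × ℝ) : frameTrd (helicoid ρ θ p) = p.2 :=
  (helicoid_apply p).2.2

lemma helicoid_of_frameFst_eq_zero {x : E3} (h : frameFst (θ / ρ) x = 0) :
    helicoid ρ θ (frameSnd (θ / ρ) x, x 2) = x := by
  obtain ⟨h0, h1, h2⟩ := helicoid_apply (ρ := ρ) (θ := θ) (frameSnd (θ / ρ) x, x 2)
  simp only [← div_mul_eq_mul_div] at h0 h1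
  have e := Real.sin_sq_add_cos_sq (θ / ρ * x 2)
  unfold frameFst at h
  unfold frameSnd at *
  ext i
  fin_cases i
  · simp only [Fin.zero_eta]
    rw [h0]
    linear_combination x 0 * e - Real.cos (θ / ρ * x 2) * h
  · simp only [Fin.mk_one]
    rw [h1]
    linear_combination x 1 * e - Real.sin (θ / ρ * x 2) * h
  · exact h2

lemma contDiff_helicoid : ContDiff ℝ 2 (helicoid ρ θ) := by
  rw [contDiff_euclidean]
  intro i
  fin_cases i
  · simp only [Fin.zero_eta, (helicoid_apply _).1]
    have : ContDiff ℝ 2 fun p : ℝ × ℝ => Real.sin (θ * p.2 / ρ) :=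
      ((contDiff_const.mul contDiff_snd).div_const ρ).sin
    exact contDiff_fst.neg.mul this
  · simp only [Fin.mk_one, (helicoid_apply _).2.1]
    have : ContDiff ℝ 2 fun p : ℝ × ℝ => Real.cos (θ * p.2 / ρ) :=
      ((contDiff_const.mul contDiff_snd).div_const ρ).cos
    exact contDiff_fst.mul this
  · have : (fun p => helicoid ρ θ p 2) = fun p => p.2 := funext fun p => (helicoid_apply p).2.2
    change ContDiff ℝ 2 fun p => helicoid ρ θ p 2
    rw [this]
    exact contDiff_snd

lemma mem_wires {x : E3} (hρ : ρ ≠ 0) : x ∈ wires ρ θ ↔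
    ∃ s ∈ Icc (-1 : ℝ) 1, x = helicoid ρ θ (s, 0) ∨ x = helicoid ρ θ (s, ρ) := by
  have h0 : ∀ s, helicoid ρ θ (s, 0) = !₂[0, s, 0] := fun s => by simp [helicoid]
  have h1 : ∀ s, helicoid ρ θ (s, ρ) = !₂[-s * Real.sin θ, s * Real.cos θ, ρ] := fun s => by
    simp [helicoid, mul_div_cancel_right₀ θ hρ]
  simp only [wires, mem_union, mem_ofPred_eq, h0, h1]
  constructor
  · rintro (⟨s, hs, h⟩ | ⟨s, hs, h⟩)
    exacts [⟨s, hs, Or.inl h⟩, ⟨s, hs, Or.inr h⟩]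
  · rintro ⟨s, hs, h | h⟩
    exacts [Or.inl ⟨s, hs, h⟩, Or.inr ⟨s, hs, h⟩]

lemma helicoid_injective : Function.Injective (helicoid ρ θ) := by
  intro p q h
  have h1 := congrArg (frameSnd (θ / ρ)) h
  have h2 := congrArg frameTrd h
  rw [frameSnd_helicoid, frameSnd_helicoid] at h1
  rw [frameTrd_helicoid, frameTrd_helicoid] at h2
  exact Prod.ext h1 h2

lemma isAdmissible_helicoid (hρ : 0 < ρ) : IsAdmissible ρ θ (helicoid ρ θ) where
  contDiffOn := contDiff_helicoid.contDiffOn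
  injOn := helicoid_injective.injOn
  image_wireEdges := by
    ext x
    rw [mem_wires hρ.ne']
    constructor
    · rintro ⟨⟨y, z⟩, ⟨hy, hz⟩, rfl⟩
      refine ⟨y, hy, ?_⟩
      rcases hz with hz | hz <;> simp only at hz <;> rw [hz]
      exacts [Or.inl rfl, Or.inr rfl]
    · rintro ⟨s, hs, rfl | rfl⟩
      exacts [⟨(s, 0), ⟨hs, by simp⟩, rfl⟩, ⟨(s, ρ), ⟨hs, by simp⟩, rfl⟩]
  image_lateralEdges := by
    rintro _ ⟨⟨y, z⟩, ⟨hy, hz⟩, rfl⟩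
    have hs := frame_sq_add_sq (θ / ρ) (helicoid ρ θ (y, z))
    rw [frameFst_helicoid, frameSnd_helicoid] at hs
    refine ⟨?_, ?_⟩
    · rw [← hs]
      rcases hy with hy | hy <;> simp only at hy <;> rw [hy] <;> norm_num
    · rw [(helicoid_apply _).2.2]
      exact Ioo_subset_Icc_self hz

end

/-! ### Closeness in the rotating frame -/

section
variable {ρ : ℝ}

/-- Composition with a `C²` function preserves `C¹`-closeness of parametrizations. -/
lemma exists_close_comp (hρ : 0 < ρ) {φ : E3 → ℝ} (hφ : ContDiff ℝ 2 φ) {X : ℝ × ℝ → E3}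
    (hX : ContDiffOn ℝ 2 X (rect ρ)) {δ : ℝ} (hδ : 0 < δ) :
    ∃ ε > 0, ∀ g : ℝ × ℝ → E3, DifferentiableOn ℝ g (rect ρ) →
      (∀ p ∈ rect ρ, ‖g p - X p‖ < ε ∧
        ‖fderivWithin ℝ g (rect ρ) p - fderivWithin ℝ X (rect ρ) p‖ < ε) →
      ∀ p ∈ rect ρ, |φ (g p) - φ (X p)| ≤ δ ∧
        |pdy ρ (φ ∘ g) p - pdy ρ (φ ∘ X) p| ≤ δ ∧ |pdz ρ (φ ∘ g) p - pdz ρ (φ ∘ X) p| ≤ δ := by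
  have hu := uniqueDiffOn_rect hρ
  have cX := hX.continuousOn
  have cDX : ContinuousOn (fderivWithin ℝ X (rect ρ)) (rect ρ) :=
    hX.continuousOn_fderivWithin hu (by norm_num)
  have hK : IsCompact ((fun p => (X p, fderivWithin ℝ X (rect ρ) p)) '' rect ρ) :=
    (isCompact_rect ρ).image_of_continuousOn (cX.prodMk cDX)
  let Φ : E3 × (ℝ × ℝ →L[ℝ] E3) → ℝ × (ℝ × ℝ →L[ℝ] ℝ) := fun q => (φ q.1, (fderiv ℝ φ q.1).comp q.2)
  have hΦ : Continuous Φ := by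
    have h1 : Continuous (fderiv ℝ φ) := hφ.continuous_fderiv (by norm_num)
    exact (hφ.continuous.comp continuous_fst).prodMk
      ((h1.comp continuous_fst).clm_comp continuous_snd)
  have huc := hK.uniformContinuousAt_of_continuousAt Φ (fun a _ => hΦ.continuousAt)
    (Metric.dist_mem_uniformity hδ)
  obtain ⟨ε, hε, h⟩ := Metric.mem_uniformity_dist.1 huc
  refine ⟨ε, hε, fun g hg hclose p hp => ?_⟩
  have hc := hclose p hp
  have key := @h (X p, fderivWithin ℝ X (rect ρ) p) (g p, fderivWithin ℝ g (rect ρ) p)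
    (by
      rw [Prod.dist_eq, max_lt_iff, dist_comm, dist_eq_norm, dist_comm, dist_eq_norm]
      exact hc)
    (mem_image_of_mem _ hp)
  simp only [mem_ofPred_eq, Φ, Prod.dist_eq, max_lt_iff] at key
  rw [dist_comm, Real.dist_eq, dist_comm, dist_eq_norm] at key
  have hd : ∀ f : ℝ × ℝ → E3, DifferentiableOn ℝ f (rect ρ) →
      fderivWithin ℝ (φ ∘ f) (rect ρ) p = (fderiv ℝ φ (f p)).comp (fderivWithin ℝ f (rect ρ) p) :=
    fun f hf => fderiv_comp_fderivWithin p (hφ.differentiable (by norm_num) _) (hf p hp) (hu p hp)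
  have hv : ∀ v : ℝ × ℝ, ‖v‖ = 1 → |fderivWithin ℝ (φ ∘ g) (rect ρ) p v -
      fderivWithin ℝ (φ ∘ X) (rect ρ) p v| ≤ δ := by
    intro v hv
    rw [hd g hg, hd X (hX.differentiableOn (by norm_num)), ← sub_apply, ← Real.norm_eq_abs]
    refine (ContinuousLinearMap.le_opNorm _ _).trans ?_
    rw [hv, mul_one]
    exact key.2.le
  exact ⟨key.1.le, hv _ (by simp [Prod.norm_def]), hv _ (by simp [Prod.norm_def])⟩

end

section
variable {ρ θ : ℝ}

/-- The derivative bounds come from `exists_close_comp`, applied to each rotating coordinate. The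
boundary values also use admissibility, and closeness to tell the two wires apart. -/
lemma exists_nearHelicoid (hρ : 0 < ρ) {δ : ℝ} (hδ : 0 < δ) :
    ∃ ε > 0, ∀ g, IsAdmissible ρ θ g →
      (∀ p ∈ rect ρ, ‖g p - helicoid ρ θ p‖ < ε ∧
        ‖fderivWithin ℝ g (rect ρ) p - fderivWithin ℝ (helicoid ρ θ) (rect ρ) p‖ < ε) →
      NearHelicoid ρ δ (frameFst (θ / ρ) ∘ g) (frameSnd (θ / ρ) ∘ g) (frameTrd ∘ g) := by
  -- The bound ρ/2 prevents an edge of the rectangle from being sent to the wire at the opposite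
  -- height.
  obtain ⟨δ', hδ'⟩ : ∃ δ', δ' = min δ (ρ / 2) := ⟨_, rfl⟩
  have h0 : 0 < δ' := by rw [hδ']; positivity
  have hle : δ' ≤ δ := by rw [hδ']; exact min_le_left _ _
  have hle' : δ' ≤ ρ / 2 := by rw [hδ']; exact min_le_right _ _
  have hX := (contDiff_helicoid (ρ := ρ) (θ := θ)).contDiffOn (s := rect ρ)
  obtain ⟨ε₁, hε₁, H1⟩ := exists_close_comp hρ (contDiff_frameFst (θ / ρ)) hX h0
  obtain ⟨ε₂, hε₂, H2⟩ := exists_close_comp hρ (contDiff_frameSnd (θ / ρ)) hX h0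
  obtain ⟨ε₃, hε₃, H3⟩ := exists_close_comp hρ contDiff_frameTrd hX h0
  refine ⟨min ε₁ (min ε₂ ε₃), by positivity, fun g hg hclose => ?_⟩
  have hdg : DifferentiableOn ℝ g (rect ρ) := hg.contDiffOn.differentiableOn (by norm_num)
  have hw := hg.image_wireEdges
  have K1 := H1 g hdg fun p hp => ⟨(hclose p hp).1.trans_le (min_le_left _ _),
    (hclose p hp).2.trans_le (min_le_left _ _)⟩
  have K2 := H2 g hdg fun p hp =>
    ⟨(hclose p hp).1.trans_le ((min_le_right _ _).trans (min_le_left _ _)),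
    (hclose p hp).2.trans_le ((min_le_right _ _).trans (min_le_left _ _))⟩
  have K3 := H3 g hdg fun p hp =>
    ⟨(hclose p hp).1.trans_le ((min_le_right _ _).trans (min_le_right _ _)),
    (hclose p hp).2.trans_le ((min_le_right _ _).trans (min_le_right _ _))⟩
  have e1 : frameFst (θ / ρ) ∘ helicoid ρ θ = fun _ => 0 := funext frameFst_helicoid
  have e2 : frameSnd (θ / ρ) ∘ helicoid ρ θ = Prod.fst := funext frameSnd_helicoid
  have e3 : frameTrd ∘ helicoid ρ θ = Prod.snd := funext frameTrd_helicoid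
  have hu := uniqueDiffOn_rect hρ
  have d1 : ∀ p v, fderivWithin ℝ (fun _ : ℝ × ℝ => (0 : ℝ)) (rect ρ) p v = 0 := by simp
  have d2 : ∀ p ∈ rect ρ, ∀ v, fderivWithin ℝ (Prod.fst : ℝ × ℝ → ℝ) (rect ρ) p v = v.1 :=
    fun p hp v => by rw [fderivWithin_fst (hu p hp)]; rfl
  have d3 : ∀ p ∈ rect ρ, ∀ v, fderivWithin ℝ (Prod.snd : ℝ × ℝ → ℝ) (rect ρ) p v = v.2 :=
    fun p hp v => by rw [fderivWithin_snd (hu p hp)]; rfl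
  have wire : ∀ y ∈ Icc (-1 : ℝ) 1, ∀ z ∈ ({0, ρ} : Set ℝ), ∃ s, g (y, z) = helicoid ρ θ (s, z) := by
    intro y hy z hz
    have hz' : z ∈ Icc 0 ρ := by
      rcases hz with rfl | hz
      · exact left_mem_Icc.2 hρ.le
      · rw [hz]; exact right_mem_Icc.2 hρ.le
    have hm : g (y, z) ∈ wires ρ θ := by rw [← hw]; exact mem_image_of_mem _ ⟨hy, hz⟩
    have hc := (K3 (y, z) ⟨hy, hz'⟩).1
    rw [frameTrd_helicoid] at hc
    rw [mem_wires hρ.ne'] at hm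
    obtain ⟨s, -, hs⟩ := hm
    refine ⟨s, ?_⟩
    rcases hs with hs | hs <;> rcases hz with hz | hz <;> rw [hz] at hs hc ⊢ <;>
      first
      | exact hs
      | (rw [hs, frameTrd_helicoid, abs_le] at hc; simp only at hc; linarith)
  have hval : ∀ y ∈ Icc (-1 : ℝ) 1, ∀ z ∈ ({0, ρ} : Set ℝ),
      (frameFst (θ / ρ) ∘ g) (y, z) = 0 ∧ (frameTrd ∘ g) (y, z) = z := by
    intro y hy z hz
    obtain ⟨s, hs⟩ := wire y hy z hz
    simp only [Function.comp_apply, hs]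
    exact ⟨frameFst_helicoid _, frameTrd_helicoid _⟩
  refine NearHelicoid.mono (δ := δ') ?_ hle
  exact
  { contDiffOn_fst := (contDiff_frameFst _).comp_contDiffOn hg.contDiffOn
    contDiffOn_snd := (contDiff_frameSnd _).comp_contDiffOn hg.contDiffOn
    contDiffOn_trd := contDiff_frameTrd.comp_contDiffOn hg.contDiffOn
    bottom := fun y hy => hval y hy 0 (by simp)
    top := fun y hy => hval y hy ρ (by simp)
    side := by
      intro y hy
      have hy' : y ∈ Icc (-1 : ℝ) 1 := by
        rcases hy with rfl | hy
        · norm_num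
        · rw [hy]; norm_num
      have hcont : ContinuousOn (fun z => (frameFst (θ / ρ) ∘ g) (y, z) ^ 2 +
          (frameSnd (θ / ρ) ∘ g) (y, z) ^ 2) (Icc 0 ρ) := by
        have c1 := ((contDiff_frameFst (θ / ρ)).comp_contDiffOn hg.contDiffOn).continuousOn
        have c2 := ((contDiff_frameSnd (θ / ρ)).comp_contDiffOn hg.contDiffOn).continuousOn
        exact ((continuousOn_vert c1 hy').pow 2).add ((continuousOn_vert c2 hy').pow 2)
      -- The wall condition is imposed only for 0 < z < ρ; continuity extends it to the corners.
      refine EqOn.of_subset_closure (s := Ioo 0 ρ) ?_ hcont continuousOn_const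
        Ioo_subset_Icc_self (by rw [closure_Ioo hρ.ne])
      intro z hz
      have := hg.image_lateralEdges (mem_image_of_mem g (show (y, z) ∈ lateralEdges ρ from ⟨hy, hz⟩))
      simp only [Function.comp_apply, frame_sq_add_sq]
      exact this.1
    abs_fst := fun p hp => by simpa [frameFst_helicoid] using (K1 p hp).1
    abs_snd := fun p hp => by simpa [frameSnd_helicoid] using (K2 p hp).1
    abs_pdy_fst := fun p hp => by simpa [e1, pdy, d1] using (K1 p hp).2.1
    abs_pdz_fst := fun p hp => by simpa [e1, pdz, d1] using (K1 p hp).2.2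
    abs_pdy_snd := fun p hp => by simpa [e2, pdy, d2 p hp] using (K2 p hp).2.1
    abs_pdz_snd := fun p hp => by simpa [e2, pdz, d2 p hp] using (K2 p hp).2.2
    abs_pdy_trd := fun p hp => by simpa [e3, pdy, d3 p hp] using (K3 p hp).2.1
    abs_pdz_trd := fun p hp => by simpa [e3, pdz, d3 p hp] using (K3 p hp).2.2 }

/-! ### The area density in the rotating frame -/

/-- The Gram determinant of the partial derivatives in terms of the rotating frame. -/
lemma gram_eq (a : ℝ) (hρ : 0 < ρ) {g : ℝ × ℝ → E3} {p : ℝ × ℝ} (hp : p ∈ rect ρ)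
    (hg : DifferentiableWithinAt ℝ g (rect ρ) p) :
    ‖fderivWithin ℝ g (rect ρ) p (1, 0)‖ ^ 2 * ‖fderivWithin ℝ g (rect ρ) p (0, 1)‖ ^ 2
      - (inner ℝ (fderivWithin ℝ g (rect ρ) p (1, 0))
          (fderivWithin ℝ g (rect ρ) p (0, 1))) ^ 2 =
    jac ρ (frameSnd a ∘ g) (frameTrd ∘ g) p ^ 2 + jac ρ (frameTrd ∘ g) (frameFst a ∘ g) p ^ 2 +
      (jac ρ (frameFst a ∘ g) (frameSnd a ∘ g) p -
        a * (frameFst a ∘ g) p * jac ρ (frameTrd ∘ g) (frameFst a ∘ g) p +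
        a * (frameSnd a ∘ g) p * jac ρ (frameSnd a ∘ g) (frameTrd ∘ g) p) ^ 2 := by
  have hu := uniqueDiffOn_rect hρ p hp
  have hd := hg.hasFDerivWithinAt
  have hi : ∀ i : Fin 3, HasFDerivWithinAt (fun q => g q i)
      ((EuclideanSpace.proj (𝕜 := ℝ) i).comp (fderivWithin ℝ g (rect ρ) p)) (rect ρ) p :=
    fun i => (EuclideanSpace.proj (𝕜 := ℝ) i).hasFDerivAt.comp_hasFDerivWithinAt p hd
  have ha := (hi 2).const_mul a
  have f1 : HasFDerivWithinAt (frameFst a ∘ g) _ (rect ρ) p :=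
    ((hi 0).mul ha.cos).add ((hi 1).mul ha.sin)
  have f2 : HasFDerivWithinAt (frameSnd a ∘ g) _ (rect ρ) p :=
    ((hi 0).neg.mul ha.sin).add ((hi 1).mul ha.cos)
  have f3 : HasFDerivWithinAt (frameTrd ∘ g) _ (rect ρ) p := hi 2
  have hpr : ∀ (i : Fin 3) (x : E3), EuclideanSpace.proj (𝕜 := ℝ) i x = x i := fun _ _ => rfl
  unfold jac pdy pdz
  rw [f1.fderivWithin hu, f2.fderivWithin hu, f3.fderivWithin hu]
  rw [EuclideanSpace.real_norm_sq_eq, EuclideanSpace.real_norm_sq_eq, PiLp.inner_apply]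
  simp only [Fin.sum_univ_three, RCLike.inner_apply, conj_trivial, Function.comp_apply, frameFst,
    frameSnd, add_apply, neg_apply, smul_apply, smul_eq_mul, ContinuousLinearMap.comp_apply,
    Pi.neg_apply, hpr]
  generalize fderivWithin ℝ g (rect ρ) p (1, 0) = u
  generalize fderivWithin ℝ g (rect ρ) p (0, 1) = v
  have e := Real.sin_sq_add_cos_sq (a * g p 2)
  generalize Real.sin (a * g p 2) = S at *
  generalize Real.cos (a * g p 2) = C at *
  generalize g p 0 = x
  generalize g p 1 = y
  generalize u.ofLp 0 = u0
  generalize u.ofLp 1 = u1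
  generalize u.ofLp 2 = u2
  generalize v.ofLp 0 = v0
  generalize v.ofLp 1 = v1
  generalize v.ofLp 2 = v2
  -- Lagrange's identity, with the cross product expressed in the rotated orthonormal frame. The
  -- factor C² + S² = 1 is kept so that the third component matches as a polynomial.
  have k1 : (u0 ^ 2 + u1 ^ 2 + u2 ^ 2) * (v0 ^ 2 + v1 ^ 2 + v2 ^ 2) -
      (v0 * u0 + v1 * u1 + v2 * u2) ^ 2 =
      (-S * (u0 * v2 - v0 * u2) + C * (u1 * v2 - v1 * u2)) ^ 2 +
      (C * (u2 * v0 - v2 * u0) + S * (u2 * v1 - v2 * u1)) ^ 2 +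
      ((C ^ 2 + S ^ 2) * (u0 * v1 - u1 * v0)) ^ 2 := by
    have e' : C ^ 2 + S ^ 2 = 1 := by linarith
    rw [e']
    linear_combination (-(u0 * v2 - v0 * u2) ^ 2 - (u1 * v2 - v1 * u2) ^ 2) * e
  rw [k1]
  congr 1
  · congr 1
    · ring
    · ring
  · ring

lemma energy_eq (σ : ℝ) (a : ℝ) (hρ : 0 < ρ) {g : ℝ × ℝ → E3} (hg : DifferentiableOn ℝ g (rect ρ)) :
    energy σ ρ g = σ * ∫ p in rect ρ, Real.sqrt
      (jac ρ (frameSnd a ∘ g) (frameTrd ∘ g) p ^ 2 + jac ρ (frameTrd ∘ g) (frameFst a ∘ g) p ^ 2 +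
      (jac ρ (frameFst a ∘ g) (frameSnd a ∘ g) p -
        a * (frameFst a ∘ g) p * jac ρ (frameTrd ∘ g) (frameFst a ∘ g) p +
        a * (frameSnd a ∘ g) p * jac ρ (frameSnd a ∘ g) (frameTrd ∘ g) p) ^ 2) := by
  rw [energy, ← integral_const_mul]
  refine setIntegral_congr_fun (measurableSet_rect ρ) fun p hp => ?_
  simp only [gram_eq a hρ hp (hg p hp)]

lemma gram_helicoid (hρ : 0 < ρ) {p : ℝ × ℝ} (hp : p ∈ rect ρ) :
    ‖fderivWithin ℝ (helicoid ρ θ) (rect ρ) p (1, 0)‖ ^ 2 *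
        ‖fderivWithin ℝ (helicoid ρ θ) (rect ρ) p (0, 1)‖ ^ 2
      - (inner ℝ (fderivWithin ℝ (helicoid ρ θ) (rect ρ) p (1, 0))
          (fderivWithin ℝ (helicoid ρ θ) (rect ρ) p (0, 1))) ^ 2 = 1 + (θ / ρ) ^ 2 * p.1 ^ 2 := by
  have hu := uniqueDiffOn_rect hρ
  rw [gram_eq (θ / ρ) hρ hp ((contDiff_helicoid.differentiable (by norm_num)).differentiableAt
    |>.differentiableWithinAt)]
  have e1 : frameFst (θ / ρ) ∘ helicoid ρ θ = fun _ => 0 := funext frameFst_helicoid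
  have e2 : frameSnd (θ / ρ) ∘ helicoid ρ θ = Prod.fst := funext frameSnd_helicoid
  have e3 : frameTrd ∘ helicoid ρ θ = Prod.snd := funext frameTrd_helicoid
  rw [e1, e2, e3]
  simp [jac, pdy, pdz, fderivWithin_fst (hu p hp), fderivWithin_snd (hu p hp)]
  ring

/-- The density is the Jacobian of the pair (`wtInt` of y, z), so Stokes leaves only the lateral
edges, which contribute equally by oddness. -/
lemma energy_helicoid (σ : ℝ) (hρ : 0 < ρ) :
    energy σ ρ (helicoid ρ θ) = σ * (2 * ρ * wtInt (θ / ρ) 1) := by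
  have hu := uniqueDiffOn_rect hρ
  have h1 : energy σ ρ (helicoid ρ θ) =
      ∫ p in rect ρ, σ * jac ρ (fun p => wtInt (θ / ρ) p.1) Prod.snd p := by
    refine setIntegral_congr_fun (measurableSet_rect ρ) fun p hp => ?_
    simp only [gram_helicoid hρ hp]
    have hd : HasFDerivWithinAt (fun p : ℝ × ℝ => wtInt (θ / ρ) p.1) _ (rect ρ) p :=
      (hasDerivAt_wtInt (θ / ρ) p.1).comp_hasFDerivWithinAt p
        (hasFDerivAt_fst (𝕜 := ℝ) (E := ℝ) (F := ℝ)).hasFDerivWithinAt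
    simp [jac, pdy, pdz, hd.fderivWithin (hu p hp), fderivWithin_snd (hu p hp), wt]
  rw [h1, integral_const_mul, integral_jac hρ (F := fun p => wtInt (θ / ρ) p.1)
    ((contDiff_wtInt _).comp contDiff_fst).contDiffOn
    contDiff_snd.contDiffOn]
  have hz : ∀ y ∈ Icc (-1 : ℝ) 1, ∀ z ∈ Icc 0 ρ, pdz ρ Prod.snd (y, z) = 1 ∧
      pdy ρ Prod.snd (y, z) = 0 := by
    intro y hy z hz
    simp [pdy, pdz, fderivWithin_snd (hu (y, z) ⟨hy, hz⟩)]
  have v : ∀ y ∈ Icc (-1 : ℝ) 1, (∫ z in (0 : ℝ)..ρ, wtInt (θ / ρ) (y, z).1 *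
      pdz ρ Prod.snd (y, z)) = ρ * wtInt (θ / ρ) y := by
    intro y hy
    rw [intervalIntegral.integral_congr (g := fun _ => wtInt (θ / ρ) y)]
    · simp
    · intro z hz'
      rw [uIcc_of_le hρ.le] at hz'
      simp [(hz y hy z hz').1]
  have w : ∀ z ∈ Icc 0 ρ, (∫ y in (-1 : ℝ)..1, wtInt (θ / ρ) (y, z).1 *
      pdy ρ Prod.snd (y, z)) = 0 := by
    intro z hz'
    rw [intervalIntegral.integral_congr (g := fun _ => (0 : ℝ))]
    · simp
    · intro y hy
      rw [uIcc_of_le (by norm_num)] at hy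
      simp [(hz y hy z hz').2]
  rw [v 1 (by norm_num), v (-1) (by norm_num), w 0 (by simp [hρ.le]), w ρ (by simp [hρ.le]),
    wtInt_neg]
  ring

end

/-! ### The energy bound and strict local minimality -/

section
variable {ρ θ : ℝ}

/-- With k the square root in the hypothesis, k² = (π/ρ)² - 2(θ/ρ)². The strict inequality persists
for κ slightly below k, which leaves room for ω² strictly between κ² + 2(θ/ρ)² and (π/ρ)²; the
midpoint is taken. -/
lemma exists_frequencies (hρ : 0 < ρ)
    (h : 1 < Real.sqrt ((Real.pi ^ 2 - 2 * θ ^ 2) / ρ ^ 2) *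
      Real.tanh (Real.sqrt ((Real.pi ^ 2 - 2 * θ ^ 2) / ρ ^ 2))) :
    ∃ κ ω : ℝ, 0 < ω ∧ ω * ρ < Real.pi ∧ 0 < ω ^ 2 - 2 * (θ / ρ) ^ 2 - κ ^ 2 ∧
      1 < κ * (Real.sinh κ / Real.cosh κ) := by
  obtain ⟨k, hk⟩ : ∃ k, k = Real.sqrt ((Real.pi ^ 2 - 2 * θ ^ 2) / ρ ^ 2) := ⟨_, rfl⟩
  rw [← hk, Real.tanh_eq_sinh_div_cosh] at h
  have hk0 : 0 < k := by
    rcases (hk ▸ Real.sqrt_nonneg _ : 0 ≤ k).lt_or_eq with h0 | h0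
    · exact h0
    · rw [← h0] at h; norm_num at h
  have hk2 : k ^ 2 = (Real.pi / ρ) ^ 2 - 2 * (θ / ρ) ^ 2 := by
    have : 0 < (Real.pi ^ 2 - 2 * θ ^ 2) / ρ ^ 2 := by
      rw [hk] at hk0; exact Real.sqrt_pos.1 hk0
    rw [hk, Real.sq_sqrt this.le]
    field_simp
  have hcont : ContinuousAt (fun x => x * (Real.sinh x / Real.cosh x)) k :=
    continuousAt_id.mul (Real.continuous_sinh.continuousAt.div Real.continuous_cosh.continuousAt
      (Real.cosh_pos k).ne')
  have hev : ∀ᶠ x in nhdsWithin k (Iio k), 1 < x * (Real.sinh x / Real.cosh x) ∧ 0 < x ∧ x < k := by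
    filter_upwards [nhdsWithin_le_nhds (hcont.eventually (lt_mem_nhds h)),
      nhdsWithin_le_nhds (lt_mem_nhds hk0), self_mem_nhdsWithin] with x h1 h2 h3
    exact ⟨h1, h2, h3⟩
  obtain ⟨κ, h1, h2, h3⟩ := hev.exists
  have hlt : κ ^ 2 < k ^ 2 := by gcongr
  have hp : 0 < Real.pi / ρ := div_pos Real.pi_pos hρ
  have hpos : 0 < (κ ^ 2 + 2 * (θ / ρ) ^ 2 + (Real.pi / ρ) ^ 2) / 2 := by positivity
  refine ⟨κ, Real.sqrt ((κ ^ 2 + 2 * (θ / ρ) ^ 2 + (Real.pi / ρ) ^ 2) / 2),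
    Real.sqrt_pos.2 hpos, ?_, ?_, h1⟩
  · rw [← lt_div_iff₀ hρ, Real.sqrt_lt' hp]
    linarith
  · rw [Real.sq_sqrt hpos.le]
    linarith

/-- Every competitor that is `C¹`-close to the helicoid has at least the energy of the helicoid,
plus a multiple of the squared distance to the helicoid. -/
theorem exists_energy_lower_bound {σ : ℝ} (hσ : 0 < σ) (hρ : 0 < ρ)
    (h : 1 < Real.sqrt ((Real.pi ^ 2 - 2 * θ ^ 2) / ρ ^ 2) *
      Real.tanh (Real.sqrt ((Real.pi ^ 2 - 2 * θ ^ 2) / ρ ^ 2))) :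
    ∃ ε > 0, ∃ c > 0, ∀ g, IsAdmissible ρ θ g →
      (∀ p ∈ rect ρ, ‖g p - helicoid ρ θ p‖ < ε ∧
        ‖fderivWithin ℝ g (rect ρ) p - fderivWithin ℝ (helicoid ρ θ) (rect ρ) p‖ < ε) →
      energy σ ρ (helicoid ρ θ) + c * ∫ p in rect ρ, frameFst (θ / ρ) (g p) ^ 2 ≤ energy σ ρ g ∧
      NearHelicoid ρ (1 / 8) (frameFst (θ / ρ) ∘ g) (frameSnd (θ / ρ) ∘ g) (frameTrd ∘ g) := by
  obtain ⟨κ, ω, hω, hωρ, hgap, hκ⟩ := exists_frequencies hρ h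
  obtain ⟨δ, hδ, c, hc, harea⟩ := exists_area_lower_bound hρ hω hωρ hgap hκ
  obtain ⟨ε, hε, hnear⟩ := exists_nearHelicoid (θ := θ) hρ (lt_min hδ (by norm_num : (0:ℝ) < 1 / 8))
  refine ⟨ε, hε, σ * c, by positivity, fun g hg hclose => ?_⟩
  have hN := hnear g hg hclose
  refine ⟨?_, hN.mono (min_le_right _ _)⟩
  rw [energy_helicoid σ hρ, energy_eq σ (θ / ρ) hρ (hg.contDiffOn.differentiableOn (by norm_num)),
    mul_assoc σ c, ← mul_add]
  exact mul_le_mul_of_nonneg_left (harea _ _ _ (hN.mono (min_le_left _ _))) hσ.le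

/-- If the transverse coordinate vanishes then the other two coordinates cover the rectangle. -/
lemma NearHelicoid.exists_eq {ξ η ζ : ℝ × ℝ → ℝ} (hρ : 0 < ρ)
    (hN : NearHelicoid ρ (1 / 8) ξ η ζ) (h0 : ∀ p ∈ rect ρ, ξ p = 0) {q : ℝ × ℝ}
    (hq : q ∈ rect ρ) : ∃ p ∈ rect ρ, η p = q.1 ∧ ζ p = q.2 := by
  set F : ℝ × ℝ → ℝ × ℝ := fun p => (η p, ζ p) with hF
  have hu := uniqueDiffOn_rect hρ
  have cF : ContDiffOn ℝ 2 F (rect ρ) := hN.contDiffOn_snd.prodMk hN.contDiffOn_trd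
  have hcpt : IsCompact (F '' rect ρ) := (isCompact_rect ρ).image_of_continuousOn cF.continuousOn
  have hmaps : ∀ p ∈ rect ρ, F p ∈ rect ρ := fun p hp =>
    mem_rect.2 ⟨abs_le.1 (hN.abs_snd_le_one le_rfl hp), hN.trd_mem hρ le_rfl hp⟩
  -- With ξ = 0 the wall condition reads η² = 1, so every edge is mapped into the boundary of the
  -- rectangle.
  have hbdry : ∀ p ∈ rect ρ, p ∉ interior (rect ρ) → F p ∉ interior (rect ρ) := by
    rintro ⟨y, z⟩ hp hpn hFp
    rw [interior_rect] at hpn hFp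
    obtain ⟨⟨a1, a2⟩, a3, a4⟩ := hFp
    obtain ⟨hy, hz⟩ : y ∈ Icc (-1 : ℝ) 1 ∧ z ∈ Icc 0 ρ := hp
    simp only [hF] at a1 a2 a3 a4
    have hs : ∀ t ∈ ({-1, 1} : Set ℝ), η (t, z) ^ 2 = 1 := by
      intro t ht
      have ht' : t ∈ Icc (-1 : ℝ) 1 := by
        rcases ht with rfl | ht
        · norm_num
        · rw [ht]; norm_num
      have := hN.side t ht z hz
      rw [h0 (t, z) ⟨ht', hz⟩] at this
      linarith
    apply hpn
    refine ⟨⟨lt_of_le_of_ne hy.1 ?_, lt_of_le_of_ne hy.2 ?_⟩,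
      lt_of_le_of_ne hz.1 ?_, lt_of_le_of_ne hz.2 ?_⟩
    · rintro rfl
      have := hs (-1) (by simp)
      nlinarith
    · intro e
      simp only at e
      subst e
      have := hs 1 (by simp)
      nlinarith
    · rintro rfl
      rw [(hN.bottom y hy).2] at a3
      exact lt_irrefl _ a3
    · intro e
      simp only at e
      subst e
      rw [(hN.top y hy).2] at a4
      exact lt_irrefl _ a4
  -- The Jacobian is at least 1/2, so F is a local diffeomorphism in the interior.
  have hopen : IsOpen (F '' interior (rect ρ)) := by
    rw [isOpen_iff_mem_nhds]
    rintro _ ⟨p, hp, rfl⟩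
    have hn := rect_mem_nhds hp
    have hpr := interior_subset hp
    have hat : ContDiffAt ℝ 2 F p := cF.contDiffAt hn
    have hstrict : HasStrictFDerivAt F (fderiv ℝ F p) p :=
      hat.hasStrictFDerivAt (by norm_num)
    have hval : ∀ v, fderiv ℝ F p v =
        (fderivWithin ℝ η (rect ρ) p v, fderivWithin ℝ ζ (rect ρ) p v) := by
      intro v
      have := ((hN.contDiffOn_snd.differentiableOn (by norm_num) p hpr).hasFDerivWithinAt.prodMk
        (hN.contDiffOn_trd.differentiableOn (by norm_num) p hpr).hasFDerivWithinAt).hasFDerivAt hn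
      rw [show fderiv ℝ F p = _ from this.fderiv]
      rfl
    have hinj : Function.Injective (fderiv ℝ F p).toLinearMap := by
      rw [← LinearMap.ker_eq_bot, LinearMap.ker_eq_bot']
      intro v hv
      have hj : jac ρ η ζ p ≠ 0 := (by
        have := hN.jac_snd_trd le_rfl hpr
        linarith : 0 < jac ρ η ζ p).ne'
      change fderiv ℝ F p v = 0 at hv
      have hdec : ∀ L : ℝ × ℝ →L[ℝ] ℝ, L v = v.1 * L (1, 0) + v.2 * L (0, 1) := by
        intro L
        have : v = v.1 • (1, 0) + v.2 • ((0, 1) : ℝ × ℝ) := by ext <;> simp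
        conv_lhs => rw [this]
        simp only [map_add, map_smul, smul_eq_mul]
      rw [hval, Prod.mk_eq_zero, hdec, hdec] at hv
      obtain ⟨e1, e2⟩ := hv
      unfold jac pdy pdz at hj
      refine Prod.ext (mul_right_cancel₀ hj ?_) (mul_right_cancel₀ hj ?_)
      · simp only [Prod.fst_zero, zero_mul]
        linear_combination (fderivWithin ℝ ζ (rect ρ) p (0, 1)) * e1 -
          (fderivWithin ℝ η (rect ρ) p (0, 1)) * e2
      · simp only [Prod.snd_zero, zero_mul]
        linear_combination (fderivWithin ℝ η (rect ρ) p (1, 0)) * e2 -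
          (fderivWithin ℝ ζ (rect ρ) p (1, 0)) * e1
    have hsurj : (fderiv ℝ F p).range = ⊤ :=
      LinearMap.range_eq_top.2 (LinearMap.injective_iff_surjective.1 hinj)
    rw [← hstrict.map_nhds_eq_of_surj hsurj]
    exact Filter.image_mem_map (isOpen_interior.mem_nhds hp)
  have himage : F '' interior (rect ρ) = F '' rect ρ ∩ interior (rect ρ) := by
    apply Subset.antisymm
    · refine subset_inter (image_mono interior_subset) (interior_maximal ?_ hopen)
      rintro _ ⟨p, hp, rfl⟩
      exact hmaps p (interior_subset hp)
    · rintro _ ⟨⟨p, hp, rfl⟩, hFp⟩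
      by_cases hpi : p ∈ interior (rect ρ)
      · exact mem_image_of_mem _ hpi
      · exact absurd hFp (hbdry p hp hpi)
  have hne : (interior (rect ρ)).Nonempty := by
    rw [interior_rect]
    exact ⟨(0, ρ / 2), by constructor <;> constructor <;> simp <;> linarith⟩
  have hconn : IsPreconnected (interior (rect ρ)) := by
    rw [interior_rect]
    exact isPreconnected_Ioo.prod isPreconnected_Ioo
  have hsub : interior (rect ρ) ⊆ F '' rect ρ := by
    -- The image of the interior is open, and it is relatively closed in the interior because
    -- `himage` cuts it out of a compact set. Connectedness makes it everything.
    have h1 := hconn.subset_of_closure_inter_subset hopen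
      (by
        obtain ⟨x, hx⟩ := hne
        have : F x ∈ F '' interior (rect ρ) := mem_image_of_mem _ hx
        exact ⟨F x, (himage ▸ this).2, this⟩)
      (by
        rw [himage]
        exact inter_subset_inter_left _ (closure_minimal inter_subset_left hcpt.isClosed))
    exact h1.trans (image_mono interior_subset)
  have hall : rect ρ ⊆ F '' rect ρ :=
    (rect_subset_closure_interior hρ).trans (closure_minimal hsub hcpt.isClosed)
  obtain ⟨p, hp, e⟩ := hall hq
  exact ⟨p, hp, congrArg Prod.fst e, congrArg Prod.snd e⟩

/-- Equality makes ∫ ξ² vanish, hence ξ = 0 by continuity, so the competitor lies on the helicoid.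
`NearHelicoid.exists_eq` then rules out a proper subset. -/
theorem isStrictLocalMinimizer_helicoid {σ : ℝ} (hσ : 0 < σ) (hρ : 0 < ρ)
    (h : 1 < Real.sqrt ((Real.pi ^ 2 - 2 * θ ^ 2) / ρ ^ 2) *
      Real.tanh (Real.sqrt ((Real.pi ^ 2 - 2 * θ ^ 2) / ρ ^ 2))) :
    IsStrictLocalMinimizer σ ρ θ (helicoid ρ θ) := by
  obtain ⟨ε, hε, c, hc, hbound⟩ := exists_energy_lower_bound hσ hρ h
  refine ⟨ε, hε, fun g hg hclose => ?_⟩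
  obtain ⟨hE, hN⟩ := hbound g hg hclose
  have hnn : 0 ≤ ∫ p in rect ρ, frameFst (θ / ρ) (g p) ^ 2 :=
    integral_nonneg fun p => sq_nonneg _
  refine ⟨by nlinarith, fun heq => ?_⟩
  have hzero : ∫ p in rect ρ, frameFst (θ / ρ) (g p) ^ 2 = 0 := by
    rw [heq] at hE
    nlinarith
  have hξ : ∀ p ∈ rect ρ, frameFst (θ / ρ) (g p) = 0 := fun p hp =>
    pow_eq_zero_iff two_ne_zero |>.1 (eqOn_zero_of_setIntegral_eq_zero hρ
      (hN.contDiffOn_fst.continuousOn.pow 2) (fun _ _ => sq_nonneg _) hzero p hp)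
  apply Subset.antisymm
  · rintro _ ⟨p, hp, rfl⟩
    refine ⟨_, ?_, helicoid_of_frameFst_eq_zero (hξ p hp)⟩
    exact mem_rect.2 ⟨abs_le.1 (hN.abs_snd_le_one le_rfl hp), hN.trd_mem hρ le_rfl hp⟩
  · rintro _ ⟨q, hq, rfl⟩
    obtain ⟨p, hp, e1, e2⟩ := hN.exists_eq hρ hξ hq
    refine ⟨p, hp, ?_⟩
    rw [← helicoid_of_frameFst_eq_zero (hξ p hp)]
    congr 1
    exact Prod.ext e1 e2

end

/-! ### The energy along a variation -/

section
variable {K : Type*} [TopologicalSpace K] [CompactSpace K]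

lemma isOpen_setOf_forall_pos : IsOpen {x : C(K, ℝ) | ∀ p, 0 < x p} := by
  have h := ContinuousMap.isOpen_setOfPred_mapsTo (X := K) (Y := ℝ) isCompact_univ
    (isOpen_Ioi (a := (0 : ℝ)))
  convert h using 1
  ext x
  simp [MapsTo]

/-- The pointwise square root of a `C²` curve of positive continuous functions is a `C²` curve. -/
lemma exists_contDiffAt_sqrt {G : ℝ → C(K, ℝ)} {t₀ : ℝ} (hG : ContDiffAt ℝ 2 G t₀)
    (hpos : ∀ p, 0 < G t₀ p) :
    ∃ S : ℝ → C(K, ℝ), ContDiffAt ℝ 2 S t₀ ∧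
      ∀ᶠ t in nhds t₀, ∀ p, S t p = Real.sqrt (G t p) := by
  let s : C(K, ℝ) := ⟨fun p => Real.sqrt (G t₀ p), by fun_prop⟩
  have hs : ∀ p, 0 < s p := fun p => Real.sqrt_pos.2 (hpos p)
  have hss : s * s = G t₀ := by
    ext p
    exact Real.mul_self_sqrt (hpos p).le
  let r : C(K, ℝ) := ⟨fun p => (2 * s p)⁻¹, by
    refine Continuous.inv₀ (by fun_prop) fun p => ?_
    have := hs p
    positivity⟩
  have hr : ∀ p, r p * (2 * s p) = 1 := fun p => inv_mul_cancel₀ (by have := hs p; positivity)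
  -- The square root is obtained from the inverse function theorem for squaring in the Banach
  -- algebra: its derivative at s is multiplication by 2s, invertible because s is positive on a
  -- compact space.
  let e : C(K, ℝ) ≃L[ℝ] C(K, ℝ) := ContinuousLinearEquiv.equivOfInverse
    (ContinuousLinearMap.mul ℝ C(K, ℝ) (s + s)) (ContinuousLinearMap.mul ℝ C(K, ℝ) r)
    (fun x => by
      ext p
      change r p * ((s p + s p) * x p) = x p
      linear_combination x p * hr p)
    (fun x => by
      ext p
      change (s p + s p) * (r p * x p) = x p
      linear_combination x p * hr p)
  let f : C(K, ℝ) → C(K, ℝ) := fun x => x * x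
  have hf : ContDiffAt ℝ 2 f s := contDiffAt_id.mul contDiffAt_id
  have hf' : HasFDerivAt f (e : C(K, ℝ) →L[ℝ] C(K, ℝ)) s := by
    refine ((hasFDerivAt_id s).mul (hasFDerivAt_id s)).congr_fderiv ?_
    ext x p
    change s p * x p + s p * x p = (s p + s p) * x p
    ring
  have hn : (2 : WithTop ℕ∞) ≠ 0 := by norm_num
  have hL := hf.to_localInverse hf' hn
  have hLs : hf.localInverse hf' hn (f s) = s := hf.localInverse_apply_image hf' hn
  have hfs : f s = G t₀ := hss
  rw [hfs] at hL hLs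
  refine ⟨fun t => hf.localInverse hf' hn (G t), hL.comp t₀ hG, ?_⟩
  have h1 : ∀ᶠ y in nhds (f s), f (hf.localInverse hf' hn y) = y :=
    (hf.hasStrictFDerivAt' hf' hn).eventually_right_inverse
  rw [hfs] at h1
  -- Nearby values of the local inverse stay positive, which identifies them with the nonnegative
  -- root.
  have h2 := (hL.comp t₀ hG).continuousAt.eventually
    (isOpen_setOf_forall_pos.mem_nhds (show _ ∈ {x : C(K, ℝ) | ∀ p, 0 < x p} by
      simp only [Function.comp_apply, hLs]; exact hs))
  filter_upwards [hG.continuousAt.eventually h1, h2] with t ht1 ht2 p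
  exact ((Real.sqrt_eq_iff_mul_self_eq_of_pos (ht2 p)).2 (DFunLike.congr_fun ht1 p)).symm

end

section
variable {ρ : ℝ}

/-- Integration over the rectangle as a continuous linear functional. -/
lemma exists_integral_clm (ρ : ℝ) : ∃ J : C(rect ρ, ℝ) →L[ℝ] ℝ, ∀ x : C(rect ρ, ℝ), ∀ F : ℝ × ℝ → ℝ,
    (∀ p : rect ρ, x p = F p) → J x = ∫ p in rect ρ, F p := by
  obtain ⟨μ, hμ⟩ : ∃ μ : Measure (rect ρ), μ = Measure.comap Subtype.val volume := ⟨_, rfl⟩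
  have hfin : IsFiniteMeasure μ := by
    constructor
    rw [hμ, (MeasurableEmbedding.subtype_coe (measurableSet_rect ρ)).comap_apply, image_univ,
      Subtype.range_coe]
    exact (isCompact_rect ρ).measure_lt_top
  have hi : ∀ x : C(rect ρ, ℝ), Integrable (fun p => x p) μ := fun x =>
    Integrable.of_bound x.continuous.aestronglyMeasurable ‖x‖
      (Filter.Eventually.of_forall fun p => x.norm_coe_le_norm p)
  refine ⟨LinearMap.mkContinuous
    { toFun := fun x => ∫ p, x p ∂μ
      map_add' := fun x y => by
        simp only [ContinuousMap.add_apply]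
        exact integral_add (hi x) (hi y)
      map_smul' := fun c x => by
        simp only [ContinuousMap.smul_apply, smul_eq_mul, integral_const_mul, RingHom.id_apply] }
    (μ.real univ) (fun x => ?_), fun x F hF => ?_⟩
  · rw [mul_comm]
    exact norm_integral_le_of_norm_le_const
      (Filter.Eventually.of_forall fun p => x.norm_coe_le_norm p)
  · change ∫ p, x p ∂μ = _
    rw [hμ, ← integral_subtype_comap (measurableSet_rect ρ) F]
    exact integral_congr_ae (Filter.Eventually.of_forall hF)

/-- The partial derivatives of a `C²` curve of `C²` maps form `C²` curves of continuous maps. -/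
lemma IsC2Curve.exists_fderivWithin (hρ : 0 < ρ) {I : Set ℝ} {f : ℝ → ℝ × ℝ → E3}
    (hf : IsC2Curve ρ I f) (v : ℝ × ℝ) :
    ∃ U : Fin 3 → ℝ → C(rect ρ, ℝ), (∀ i, ContDiffOn ℝ 2 (U i) I) ∧
      ∀ t ∈ I, ∀ p : rect ρ, ∀ i, U i t p = fderivWithin ℝ (f t) (rect ρ) p v i := by
  obtain ⟨Γ, hΓ, hval⟩ := hf.2 1 (by norm_num)
  refine ⟨fun i t => ((EuclideanSpace.proj (𝕜 := ℝ) i).comp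
    (ContinuousMultilinearMap.apply ℝ (fun _ : Fin 1 => ℝ × ℝ) E3 (fun _ => v))).compLeftContinuous
      ℝ (rect ρ) (Γ t), fun i => ?_, fun t ht p i => ?_⟩
  · exact (ContinuousLinearMap.contDiff _).comp_contDiffOn hΓ
  · change (Γ t p (fun _ => v)) i = _
    rw [hval t ht p, iteratedFDerivWithin_one_apply (uniqueDiffOn_rect hρ p p.2)]

/-- The Gram determinant is a polynomial in curves of continuous functions, positive at t₀; its
square root is again a C² curve, and integration is continuous and linear. -/
theorem contDiffAt_energy (σ : ℝ) (hρ : 0 < ρ) {I : Set ℝ} {f : ℝ → ℝ × ℝ → E3} {t₀ : ℝ}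
    (hI : I ∈ nhds t₀) (hf : IsC2Curve ρ I f)
    (hpos : ∀ p ∈ rect ρ, 0 < ‖fderivWithin ℝ (f t₀) (rect ρ) p (1, 0)‖ ^ 2 *
        ‖fderivWithin ℝ (f t₀) (rect ρ) p (0, 1)‖ ^ 2
      - (inner ℝ (fderivWithin ℝ (f t₀) (rect ρ) p (1, 0))
          (fderivWithin ℝ (f t₀) (rect ρ) p (0, 1))) ^ 2) :
    ContDiffAt ℝ 2 (fun t => energy σ ρ (f t)) t₀ := by
  obtain ⟨U, hU, hUv⟩ := hf.exists_fderivWithin hρ (1, 0)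
  obtain ⟨V, hV, hVv⟩ := hf.exists_fderivWithin hρ (0, 1)
  obtain ⟨J, hJ⟩ := exists_integral_clm ρ
  let G : ℝ → C(rect ρ, ℝ) := fun t =>
    (U 0 t ^ 2 + U 1 t ^ 2 + U 2 t ^ 2) * (V 0 t ^ 2 + V 1 t ^ 2 + V 2 t ^ 2) -
      (U 0 t * V 0 t + U 1 t * V 1 t + U 2 t * V 2 t) ^ 2
  have hG : ContDiffAt ℝ 2 G t₀ := by
    have u := fun i => (hU i).contDiffAt hI
    have v := fun i => (hV i).contDiffAt hI
    exact (((((u 0).pow 2).add ((u 1).pow 2)).add ((u 2).pow 2)).mul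
      ((((v 0).pow 2).add ((v 1).pow 2)).add ((v 2).pow 2))).sub
      (((((u 0).mul (v 0)).add ((u 1).mul (v 1))).add ((u 2).mul (v 2))).pow 2)
  have hGv : ∀ t ∈ I, ∀ p : rect ρ, G t p = ‖fderivWithin ℝ (f t) (rect ρ) p (1, 0)‖ ^ 2 *
        ‖fderivWithin ℝ (f t) (rect ρ) p (0, 1)‖ ^ 2
      - (inner ℝ (fderivWithin ℝ (f t) (rect ρ) p (1, 0))
          (fderivWithin ℝ (f t) (rect ρ) p (0, 1))) ^ 2 := by
    intro t ht p
    rw [EuclideanSpace.real_norm_sq_eq, EuclideanSpace.real_norm_sq_eq, PiLp.inner_apply]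
    simp only [Fin.sum_univ_three, RCLike.inner_apply, conj_trivial, ← hUv t ht, ← hVv t ht]
    change (U 0 t p ^ 2 + U 1 t p ^ 2 + U 2 t p ^ 2) * (V 0 t p ^ 2 + V 1 t p ^ 2 + V 2 t p ^ 2) -
      (U 0 t p * V 0 t p + U 1 t p * V 1 t p + U 2 t p * V 2 t p) ^ 2 = _
    ring
  obtain ⟨S, hS, hSv⟩ := exists_contDiffAt_sqrt hG fun p => by
    rw [hGv t₀ (mem_of_mem_nhds hI) p]; exact hpos p p.2
  have hE : ContDiffAt ℝ 2 (fun t => σ * J (S t)) t₀ :=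
    contDiffAt_const.mul (J.contDiff.contDiffAt.comp t₀ hS)
  refine hE.congr_of_eventuallyEq ?_
  filter_upwards [hI, hSv] with t ht hs
  rw [energy, integral_const_mul, hJ (S t) (fun p => Real.sqrt
    (‖fderivWithin ℝ (f t) (rect ρ) p (1, 0)‖ ^ 2 * ‖fderivWithin ℝ (f t) (rect ρ) p (0, 1)‖ ^ 2
      - (inner ℝ (fderivWithin ℝ (f t) (rect ρ) p (1, 0))
          (fderivWithin ℝ (f t) (rect ρ) p (0, 1))) ^ 2))]
  intro p
  rw [hs p, hGv t ht p]

/-- A function that stays above a parabola touching it has at least its second derivative. -/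
lemma deriv_deriv_ge_of_parabola_le {φ : ℝ → ℝ} {k : ℝ} (hφ : ContDiffAt ℝ 2 φ 0) (hk : 0 ≤ k)
    (h : ∀ᶠ t in nhds 0, φ 0 + k * t ^ 2 ≤ φ t) :
    deriv φ 0 = 0 ∧ 2 * k ≤ deriv (deriv φ) 0 := by
  have hmin : IsLocalMin φ 0 := by
    filter_upwards [h] with t ht
    nlinarith [mul_nonneg hk (sq_nonneg t)]
  refine ⟨hmin.deriv_eq_zero, ?_⟩
  set ψ : ℝ → ℝ := fun t => φ t - k * t ^ 2 with hψ
  have hd : ∀ᶠ t in nhds 0, DifferentiableAt ℝ φ t :=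
    (hφ.eventually (by norm_num)).mono fun t ht => ht.differentiableAt (by norm_num)
  have hdd : DifferentiableAt ℝ (deriv φ) 0 :=
    (hφ.derivWithin (m := 1) (by norm_num)).differentiableAt (by norm_num)
  have hp : ∀ t : ℝ, HasDerivAt (fun t => k * t ^ 2) (2 * k * t) t := fun t => by
    refine ((hasDerivAt_pow 2 t).const_mul k).congr_deriv ?_
    push_cast; ring
  have h1 : deriv ψ =ᶠ[nhds 0] fun t => deriv φ t - 2 * k * t := by
    filter_upwards [hd] with t ht
    exact (ht.hasDerivAt.sub (hp t)).deriv
  have h2 : deriv (deriv ψ) 0 = deriv (deriv φ) 0 - 2 * k := by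
    rw [h1.deriv_eq]
    have := hdd.hasDerivAt.sub ((hasDerivAt_id (0 : ℝ)).const_mul (2 * k))
    rw [show (fun t => deriv φ t - 2 * k * t) = deriv φ - fun t => 2 * k * id t from rfl,
      this.deriv, mul_one]
  have hψmin : IsLocalMin ψ 0 := by
    filter_upwards [h] with t ht
    simp only [hψ]
    linarith
  -- If the bound failed, φ minus the parabola would have a strictly negative second derivative at a
  -- local minimum. It would then also have a local maximum there, hence be locally constant, which
  -- is absurd.
  by_contra hlt
  have hneg : deriv (deriv ψ) 0 < 0 := by rw [h2]; linarith
  have hψc : ContinuousAt ψ 0 := hφ.continuousAt.sub (by fun_prop)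
  have hmax := isLocalMax_of_deriv_deriv_neg hneg hψmin.deriv_eq_zero hψc
  have hconst : ψ =ᶠ[nhds 0] fun _ => ψ 0 := by
    filter_upwards [hψmin, hmax] with t ht1 ht2 using le_antisymm ht2 ht1
  have h3 := hconst.deriv.deriv_eq
  simp at h3
  linarith

end

/-! ### Closeness and quadratic growth along a variation -/

section
variable {ρ θ : ℝ}

/-- A vector annihilated by the differential of the transverse coordinate is tangent to the
helicoid. -/
lemma exists_eq_fderiv_helicoid (p : ℝ × ℝ) {v : E3}
    (hv : fderiv ℝ (frameFst (θ / ρ)) (helicoid ρ θ p) v = 0) :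
    ∃ w, v = fderiv ℝ (helicoid ρ θ) p w := by
  let e : E3 → E3 := fun x => !₂[Real.cos (θ / ρ * x 2), Real.sin (θ / ρ * x 2), 0]
  -- Differentiating this splitting at a point with ξ = 0 gives v = DX(w) + dξ(v) e, so dξ(v) = 0
  -- leaves a tangent vector.
  have hid : ∀ x : E3, x = helicoid ρ θ (frameSnd (θ / ρ) x, frameTrd x) +
      frameFst (θ / ρ) x • e x := by
    intro x
    obtain ⟨h0, h1, h2⟩ := helicoid_apply (ρ := ρ) (θ := θ) (frameSnd (θ / ρ) x, x 2)
    simp only [← div_mul_eq_mul_div] at h0 h1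
    have h3 := Real.sin_sq_add_cos_sq (θ / ρ * x 2)
    ext i
    fin_cases i
    · change x 0 = helicoid ρ θ (frameSnd (θ / ρ) x, x 2) 0 +
        frameFst (θ / ρ) x * Real.cos (θ / ρ * x 2)
      rw [h0, frameFst, frameSnd]
      linear_combination -x 0 * h3
    · change x 1 = helicoid ρ θ (frameSnd (θ / ρ) x, x 2) 1 +
        frameFst (θ / ρ) x * Real.sin (θ / ρ * x 2)
      rw [h1, frameFst, frameSnd]
      linear_combination -x 1 * h3
    · change x 2 = helicoid ρ θ (frameSnd (θ / ρ) x, x 2) 2 + frameFst (θ / ρ) x * 0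
      rw [h2]; ring
  have he : ContDiff ℝ 2 e := by
    have h2 := (contDiff_const (c := θ / ρ)).mul (contDiff_coord 2)
    rw [contDiff_euclidean]
    intro i
    fin_cases i
    · exact h2.cos
    · exact h2.sin
    · exact contDiff_const
  have hne : (2 : WithTop ℕ∞) ≠ 0 := by norm_num
  set x := helicoid ρ θ p with hx
  have d1 := ((contDiff_frameFst (θ / ρ)).differentiable hne x).hasFDerivAt
  have d2 := ((contDiff_frameSnd (θ / ρ)).differentiable hne x).hasFDerivAt
  have d3 := (contDiff_frameTrd.differentiable hne x).hasFDerivAt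
  have d4 := (he.differentiable hne x).hasFDerivAt
  have hp : (frameSnd (θ / ρ) x, frameTrd x) = p := by
    rw [hx, frameSnd_helicoid, frameTrd_helicoid]
  have d5 : HasFDerivAt (helicoid ρ θ) (fderiv ℝ (helicoid ρ θ) p)
      (frameSnd (θ / ρ) x, frameTrd x) := by
    rw [hp]; exact (contDiff_helicoid.differentiable hne p).hasFDerivAt
  have d6 := (d5.comp x (d2.prodMk d3)).add (d1.smul d4)
  have d7 : HasFDerivAt (fun x : E3 => x) _ x :=
    d6.congr_of_eventuallyEq (Filter.Eventually.of_forall hid)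
  have d8 := congrArg (fun L => L v) (d7.unique (hasFDerivAt_id x))
  have hz : frameFst (θ / ρ) x = 0 := frameFst_helicoid p
  refine ⟨(fderiv ℝ (frameSnd (θ / ρ)) x v, fderiv ℝ frameTrd x v), ?_⟩
  simp [hz, hv] at d8
  exact d8.symm

/-- Lipschitz estimate for the transverse coordinate on bounded sets. -/
lemma exists_frameFst_lipschitz (a R : ℝ) : ∃ C, 0 ≤ C ∧ ∀ x y : E3, ‖x‖ ≤ R → ‖y‖ ≤ R →
    |frameFst a x - frameFst a y| ≤ C * ‖x - y‖ := by
  have hc : Continuous (fderiv ℝ (frameFst a)) :=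
    (contDiff_frameFst a).continuous_fderiv (by norm_num)
  obtain ⟨C, hC⟩ := (isCompact_closedBall (0 : E3) R).exists_bound_of_continuousOn hc.continuousOn
  refine ⟨max C 0, le_max_right _ _, fun x y hx hy => ?_⟩
  rw [← Real.norm_eq_abs]
  refine (convex_closedBall (0 : E3) R).norm_image_sub_le_of_norm_fderiv_le
    (fun z _ => (contDiff_frameFst a).differentiable (by norm_num) z)
    (fun z hz => (hC z hz).trans (le_max_left _ _)) ?_ ?_ <;> simpa

/-- Along a variation the squared distance to the helicoid grows at least quadratically, if the
normal component of the initial velocity does not vanish. -/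
lemma exists_quadratic_growth (hρ : 0 < ρ) {I : Set ℝ} (hI : I ∈ nhds (0 : ℝ))
    {f : ℝ → ℝ × ℝ → E3} (hf : IsC2Curve ρ I f) (h0 : EqOn (f 0) (helicoid ρ θ) (rect ρ))
    (hnt : ¬ HasTangentialVelocity ρ (helicoid ρ θ) f) :
    ∃ k > 0, ∀ᶠ t in nhds (0 : ℝ), k * t ^ 2 ≤ ∫ p in rect ρ, frameFst (θ / ρ) (f t p) ^ 2 := by
  obtain ⟨Γ, hΓ, hval⟩ := hf.2 0 (by norm_num)
  let Λ := (ContinuousMultilinearMap.apply ℝ (fun _ : Fin 0 => ℝ × ℝ) E3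
    (fun _ => 0)).compLeftContinuous ℝ (rect ρ)
  let U : ℝ → C(rect ρ, E3) := fun t => Λ (Γ t)
  have hU : ∀ t ∈ I, ∀ p : rect ρ, U t p = f t p := by
    intro t ht p
    change Γ t p (fun _ => 0) = _
    rw [hval t ht p, iteratedFDerivWithin_zero_apply]
  have hUd : DifferentiableAt ℝ U 0 :=
    Λ.differentiableAt.comp (0 : ℝ) ((hΓ.contDiffAt hI).differentiableAt (by norm_num))
  obtain ⟨V, hV⟩ : ∃ V, HasDerivAt U V 0 := ⟨_, hUd.hasDerivAt⟩
  have hfd : ∀ p : rect ρ, HasDerivAt (fun t => f t p) (V p) 0 := by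
    intro p
    have := (ContinuousMap.evalCLM ℝ p).hasFDerivAt.comp_hasDerivAt (0 : ℝ) hV
    refine HasDerivAt.congr_of_eventuallyEq (f := fun t => U t p) this ?_
    filter_upwards [hI] with t ht using (hU t ht p).symm
  have hne : (2 : WithTop ℕ∞) ≠ 0 := by norm_num
  obtain ⟨φ, hφ⟩ : ∃ φ : C(rect ρ, ℝ), ∀ p : rect ρ,
      φ p = fderiv ℝ (frameFst (θ / ρ)) (helicoid ρ θ p) (V p) := by
    refine ⟨⟨fun p => fderiv ℝ (frameFst (θ / ρ)) (helicoid ρ θ p) (V p), ?_⟩, fun _ => rfl⟩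
    have h1 := (contDiff_frameFst (θ / ρ)).continuous_fderiv hne
    exact (h1.comp (contDiff_helicoid.continuous.comp continuous_subtype_val)).clm_apply V.continuous
  have hφd : ∀ p : rect ρ, HasDerivAt (fun t => frameFst (θ / ρ) (f t p)) (φ p) 0 := by
    intro p
    have h1 : HasFDerivAt (frameFst (θ / ρ)) (fderiv ℝ (frameFst (θ / ρ)) (helicoid ρ θ p)) (f 0 p) := by
      rw [h0 p.2]; exact ((contDiff_frameFst (θ / ρ)).differentiable hne _).hasFDerivAt
    rw [hφ]
    exact h1.comp_hasDerivAt (0 : ℝ) (hfd p)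
  have hξ0 : ∀ p : rect ρ, frameFst (θ / ρ) (f 0 p) = 0 := fun p => by
    rw [h0 p.2, frameFst_helicoid]
  -- φ is the initial rate of change of ξ; if it vanished everywhere the velocity would be
  -- tangential.
  obtain ⟨p₀, hp₀⟩ : ∃ p : rect ρ, φ p ≠ 0 := by
    by_contra! hall
    apply hnt
    intro p hp
    rw [(hfd ⟨p, hp⟩).deriv]
    have h1 := hall ⟨p, hp⟩
    rw [hφ] at h1
    obtain ⟨w, hw⟩ := exists_eq_fderiv_helicoid p h1
    refine ⟨w, ?_⟩
    rw [hw, fderivWithin_eq_fderiv (uniqueDiffOn_rect hρ p hp)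
      (contDiff_helicoid.differentiable hne p)]
  obtain ⟨R, hR⟩ : ∃ R, R = ‖U 0‖ + 1 := ⟨_, rfl⟩
  obtain ⟨C, hC0, hC⟩ := exists_frameFst_lipschitz (θ / ρ) R
  obtain ⟨B, hB⟩ := hV.isBigO_sub.bound
  have hev : ∀ᶠ t in nhds (0 : ℝ), t ∈ I ∧ ∀ p : rect ρ, |frameFst (θ / ρ) (f t p)| ≤ C * B * |t| := by
    filter_upwards [hI, hB, hUd.continuousAt.norm.eventually
      (gt_mem_nhds (show ‖U 0‖ < R by rw [hR]; linarith))] with t ht hb hr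
    refine ⟨ht, fun p => ?_⟩
    have h1 := hC (U t p) (U 0 p) (((U t).norm_coe_le_norm p).trans hr.le)
      (((U 0).norm_coe_le_norm p).trans (by rw [hR]; linarith))
    have h2 := (U t - U 0).norm_coe_le_norm p
    rw [hU t ht, hU 0 (mem_of_mem_nhds hI), hξ0, sub_zero] at h1
    rw [ContinuousMap.sub_apply, hU t ht, hU 0 (mem_of_mem_nhds hI)] at h2
    rw [sub_zero, Real.norm_eq_abs] at hb
    calc _ ≤ C * ‖f t p - f 0 p‖ := h1
      _ ≤ C * (B * |t|) := by gcongr; exact h2.trans hb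
      _ = C * B * |t| := by ring
  have hcont : ∀ t ∈ I, ContinuousOn (fun p => frameFst (θ / ρ) (f t p)) (rect ρ) := fun t ht =>
    (contDiff_frameFst (θ / ρ)).continuous.comp_continuousOn (hf.1 t ht).continuousOn
  let ψ : ℝ × ℝ → ℝ := fun p => deriv (fun t => frameFst (θ / ρ) (f t p)) 0
  have hψ : ∀ p : rect ρ, ψ p = φ p := fun p => (hφd p).deriv
  have hψc : ContinuousOn ψ (rect ρ) := by
    rw [continuousOn_iff_continuous_domRestrict]
    exact φ.continuous.congr fun p => (hψ p).symm
  -- Dominated convergence for the squared difference quotients of ξ. Differentiability of the curve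
  -- in the uniform norm supplies the constant dominating function.
  have hlim : Filter.Tendsto (fun t => ∫ p in rect ρ, (frameFst (θ / ρ) (f t p) / t) ^ 2)
      (nhdsWithin 0 {0}ᶜ) (nhds (∫ p in rect ρ, ψ p ^ 2)) := by
    refine tendsto_integral_filter_of_dominated_convergence (fun _ => (C * B) ^ 2) ?_ ?_ ?_ ?_
    · filter_upwards [nhdsWithin_le_nhds hI] with t ht
      exact (((hcont t ht).div_const t).pow 2).aestronglyMeasurable (measurableSet_rect ρ)
    · filter_upwards [nhdsWithin_le_nhds hev, self_mem_nhdsWithin] with t ht ht0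
      refine (ae_restrict_iff' (measurableSet_rect ρ)).2 (Filter.Eventually.of_forall fun p hp => ?_)
      have h1 := ht.2 ⟨p, hp⟩
      have ht1 : 0 < |t| := abs_pos.2 ht0
      rw [norm_pow, Real.norm_eq_abs, abs_div]
      gcongr
      rwa [div_le_iff₀ ht1]
    · exact integrableOn_const (isCompact_rect ρ).measure_ne_top
    · refine (ae_restrict_iff' (measurableSet_rect ρ)).2 (Filter.Eventually.of_forall fun p hp => ?_)
      have h1 := (hasDerivAt_iff_tendsto_slope.1 (hφd ⟨p, hp⟩))
      rw [hψ ⟨p, hp⟩]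
      refine Filter.Tendsto.pow (h1.congr fun t => ?_) 2
      rw [slope_def_field, hξ0 ⟨p, hp⟩, sub_zero, sub_zero]
  have hpos : 0 < ∫ p in rect ρ, ψ p ^ 2 := by
    refine lt_of_le_of_ne (integral_nonneg fun p => sq_nonneg _) fun h => hp₀ ?_
    have := eqOn_zero_of_setIntegral_eq_zero hρ (hψc.pow 2) (fun _ _ => sq_nonneg _) h.symm p₀ p₀.2
    rw [← hψ]
    exact pow_eq_zero_iff two_ne_zero |>.1 this
  -- Half of the positive limit is a lower bound for the quotients at small t ≠ 0.
  refine ⟨(∫ p in rect ρ, ψ p ^ 2) / 2, by positivity, ?_⟩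
  have hev2 := hlim.eventually (lt_mem_nhds (half_lt_self hpos))
  rw [eventually_nhdsWithin_iff] at hev2
  filter_upwards [hev2] with t ht
  rcases eq_or_ne t 0 with rfl | ht0
  · simp only [ne_eq, OfNat.ofNat_ne_zero, not_false_eq_true, zero_pow, mul_zero]
    exact integral_nonneg fun p => sq_nonneg _
  · have h1 := ht ht0
    simp only [div_pow, integral_div] at h1
    rw [lt_div_iff₀ (by positivity)] at h1
    exact h1.le

/-- Competitors along a variation are eventually `C¹`-close to the surface. -/
lemma eventually_close (hρ : 0 < ρ) {I : Set ℝ} (hI : I ∈ nhds (0 : ℝ)) {X : ℝ × ℝ → E3}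
    {f : ℝ → ℝ × ℝ → E3} (hf : IsC2Curve ρ I f) (h0 : EqOn (f 0) X (rect ρ)) {ε : ℝ} (hε : 0 < ε) :
    ∀ᶠ t in nhds (0 : ℝ), ∀ p ∈ rect ρ, ‖f t p - X p‖ < ε ∧
      ‖fderivWithin ℝ (f t) (rect ρ) p - fderivWithin ℝ X (rect ρ) p‖ < ε := by
  have key : ∀ k : ℕ, k ≤ 2 → ∀ᶠ t in nhds (0 : ℝ), ∀ p ∈ rect ρ,
      ‖iteratedFDerivWithin ℝ k (f t) (rect ρ) p - iteratedFDerivWithin ℝ k X (rect ρ) p‖ < ε := by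
    intro k hk
    obtain ⟨Γ, hΓ, hval⟩ := hf.2 k hk
    have hc := (hΓ.contDiffAt hI).continuousAt
    filter_upwards [hI, hc.eventually (Metric.ball_mem_nhds _ hε)] with t ht hb p hp
    have h1 := ((Γ t - Γ 0).norm_coe_le_norm ⟨p, hp⟩).trans_lt (by rwa [← dist_eq_norm])
    rw [ContinuousMap.sub_apply, hval t ht, hval 0 (mem_of_mem_nhds hI)] at h1
    rwa [← iteratedFDerivWithin_congr h0 hp]
  filter_upwards [key 0 (by norm_num), key 1 (by norm_num)] with t h1 h2 p hp
  constructor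
  · refine lt_of_le_of_lt ?_ (h1 p hp)
    have := (iteratedFDerivWithin ℝ 0 (f t) (rect ρ) p -
      iteratedFDerivWithin ℝ 0 X (rect ρ) p).le_opNorm (fun _ => 0)
    simpa using this
  · refine lt_of_le_of_lt (ContinuousLinearMap.opNorm_le_bound _ (norm_nonneg _) fun v => ?_)
      (h2 p hp)
    have := (iteratedFDerivWithin ℝ 1 (f t) (rect ρ) p -
      iteratedFDerivWithin ℝ 1 X (rect ρ) p).le_opNorm (fun _ => v)
    have hu := uniqueDiffOn_rect hρ p hp
    simpa [iteratedFDerivWithin_one_apply hu] using this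

lemma contDiffAt_energy_variation (σ : ℝ) (hρ : 0 < ρ) {I : Set ℝ} (hI : I ∈ nhds (0 : ℝ))
    {f : ℝ → ℝ × ℝ → E3} (hf : IsC2Curve ρ I f) (h0 : EqOn (f 0) (helicoid ρ θ) (rect ρ)) :
    ContDiffAt ℝ 2 (fun t => energy σ ρ (f t)) 0 := by
  refine contDiffAt_energy σ hρ hI hf fun p hp => ?_
  rw [fderivWithin_congr h0 (h0 hp), gram_helicoid hρ hp]
  positivity

lemma energy_congr {σ : ℝ} {g g' : ℝ × ℝ → E3} (h : EqOn g g' (rect ρ)) :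
    energy σ ρ g = energy σ ρ g' := by
  refine setIntegral_congr_fun (measurableSet_rect ρ) fun p hp => ?_
  simp only [fderivWithin_congr h (h hp)]

end

end SoapFilm

theorem proposition5p5 (σ ρ θ : ℝ) (hσ : 0 < σ) (hρ : 0 < ρ)
    (h : 1 < Real.sqrt ((Real.pi ^ 2 - 2 * θ ^ 2) / ρ ^ 2) *
      Real.tanh (Real.sqrt ((Real.pi ^ 2 - 2 * θ ^ 2) / ρ ^ 2))) :
    SoapFilm.IsStable σ ρ θ (SoapFilm.helicoid ρ θ) := by
  have key : ∀ f, SoapFilm.IsVariation ρ θ (SoapFilm.helicoid ρ θ) f →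
      ContDiffAt ℝ 2 (fun t => SoapFilm.energy σ ρ (f t)) 0 ∧
      deriv (fun t => SoapFilm.energy σ ρ (f t)) 0 = 0 ∧
      0 ≤ deriv (deriv fun t => SoapFilm.energy σ ρ (f t)) 0 ∧
      (¬ SoapFilm.HasTangentialVelocity ρ (SoapFilm.helicoid ρ θ) f →
        0 < deriv (deriv fun t => SoapFilm.energy σ ρ (f t)) 0) := by
    rintro f ⟨a, b, ha, hb, hf, hadm, h0⟩
    have hI : Ioo a b ∈ nhds (0 : ℝ) := Ioo_mem_nhds ha hb
    have hC2 := SoapFilm.contDiffAt_energy_variation (θ := θ) σ hρ hI hf h0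
    obtain ⟨ε, hε, c, hc, hbound⟩ := SoapFilm.exists_energy_lower_bound hσ hρ h
    have hlow : ∀ᶠ t in nhds (0 : ℝ), SoapFilm.energy σ ρ (f 0) +
        c * ∫ p in SoapFilm.rect ρ, SoapFilm.frameFst (θ / ρ) (f t p) ^ 2 ≤
          SoapFilm.energy σ ρ (f t) := by
      filter_upwards [hI, SoapFilm.eventually_close hρ hI hf h0 hε] with t ht hclose
      rw [SoapFilm.energy_congr h0]
      exact (hbound (f t) (hadm t ht) hclose).1
    have hpar : ∀ k, 0 ≤ k → (∀ᶠ t in nhds (0 : ℝ),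
        k * t ^ 2 ≤ ∫ p in SoapFilm.rect ρ, SoapFilm.frameFst (θ / ρ) (f t p) ^ 2) →
        deriv (fun t => SoapFilm.energy σ ρ (f t)) 0 = 0 ∧
        2 * (c * k) ≤ deriv (deriv fun t => SoapFilm.energy σ ρ (f t)) 0 := by
      intro k hk hev
      refine SoapFilm.deriv_deriv_ge_of_parabola_le hC2 (by positivity) ?_
      filter_upwards [hlow, hev] with t h1 h2
      have := mul_le_mul_of_nonneg_left h2 hc.le
      linarith
    -- The degenerate parabola k = 0 already yields criticality and a nonnegative second derivative
    -- for every variation.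
    have hzero := hpar 0 le_rfl (Filter.Eventually.of_forall fun t => by
      rw [zero_mul]
      exact MeasureTheory.integral_nonneg fun p => sq_nonneg _)
    refine ⟨hC2, hzero.1, by linarith [hzero.2], fun hnt => ?_⟩
    obtain ⟨k, hk, hev⟩ := SoapFilm.exists_quadratic_growth hρ hI hf h0 hnt
    exact lt_of_lt_of_le (by positivity) (hpar k hk.le hev).2
  refine ⟨SoapFilm.isAdmissible_helicoid hρ, fun f hf => ?_, fun f hf => ?_,
    SoapFilm.isStrictLocalMinimizer_helicoid hσ hρ h⟩
  · obtain ⟨h1, h2, -⟩ := key f hf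
    have h3 := (h1.differentiableAt (by norm_num)).hasDerivAt
    rwa [h2] at h3
  · obtain ⟨h1, -, h2, h3⟩ := key f hf
    exact ⟨h1, h2, h3⟩
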